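/- **Conventions.** $[n]=\{1,\dots,n\}$ and $\mathcal A=\binom{[n]}{k}$. For families $\mathcal F,\mathcal S\subset 2^{[n]}$ let $\mathcal F[\mathcal S]=\{F\in\mathcal F:\ A\subset F\text{ for some }A\in\mathcal S\}$. Let $\nu(\mathcal F,t)$ be the supremum of all $m$ for which there are $F_1,\dots,F_m\in\mathcal F$ (not necessarily distinct) with $|F_i\cap F_j|\le t-1$ for all $1\le i<j\le m$. Let $h(n,k,s,t)$ be the maximum of $|\mathcal A[\mathcal K]|$ over all unions of $s$ cliques $\mathcal K=\bigcup_{i=1}^s\binom{Y_i}{t+x_i}$ with integers $0\le x_i\le k-t$ and sets $Y_i\subset[n]$, $|Y_i|=t+2x_i$ (and $h=0$ if $k<t$). If $n\ge s(2k-t)$, then this maximum is attained with pairwise disjoint $Y_1,\dots,Y_s$. **Theorem.** There is an absolute constant $C>0$ such that the following holds. Let $n,k,s,t,\ell$ be positive integers with $n,k\ge 2$, $t\ge 400\ell^3s$, $n>k+C(st)^{1/2}(k-t)$ and $n\ge Cs\ell^4(k-t)$. Let $\mathcal S$ be a family of subsets of $[n]$ of size at most $t+\ell$ with $\nu(\mathcal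 S,t)\le s$, and let $\mathcal F$ be a family of subsets of $[n]$ with $\mathcal F[\mathcal S]\subset\mathcal A[\mathcal S]$ and $$|\mathcal F[\mathcal S]|>h(n,k,s,t)-\Big(\frac12+\frac1{10s}\Big)h(n,k,1,t).$$ Then there exist integers $x_1,\dots,x_s$ with $0\le x_i\le \ell$ and sets $X_1,\dots,X_s\subset[n]$ with $|X_i|=t+2x_i$ such that, putting $\mathcal C_i=\binom{X_i}{t+x_i}$, we have $\mathcal S=\mathcal S\big[\bigcup_{i=1}^s\mathcal C_i\big]$, that is, every set of $\mathcal S$ contains a member of one of the cliques $\mathcal C_i$. -/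

import Mathlib

namespace HajnalRothschild

/-- The complete `k`-uniform family `([n] choose k)`; the ground set `[n]` is `Fin n`. -/
def ambient (n k : ℕ) : Finset (Finset (Fin n)) :=
  Finset.powersetCard k Finset.univ

/-- `F[S]`: the members of `F` that contain at least one member of `S`. -/
def restrict {n : ℕ} (F S : Finset (Finset (Fin n))) : Finset (Finset (Fin n)) :=
  F.filter fun B => ∃ A ∈ S, A ⊆ B

/-- `F` contains `F_1, …, F_m` with `|F_i ∩ F_j| < t` for all `i ≠ j`. The `F_i` are indexed and
not required to be distinct, so that a set with fewer than `t` elements may be repeated at will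
(a set with at least `t` elements can occur only once). -/
def HasMatching {n : ℕ} (F : Finset (Finset (Fin n))) (t m : ℕ) : Prop :=
  ∃ f : Fin m → Finset (Fin n), (∀ i, f i ∈ F) ∧ ∀ i j, i ≠ j → (f i ∩ f j).card < t

/-- `ν(F, t)`: the largest `m` for which `F` has a `t`-matching of size `m`. It is `∞` if `F`
contains a set with fewer than `t` elements. -/
noncomputable def matchingNumber {n : ℕ} (F : Finset (Finset (Fin n))) (t : ℕ) : ℕ∞ :=
  ⨆ m : {m : ℕ // HasMatching F t m}, (m.1 : ℕ∞)

/-- The union of the `s` cliques `(Y_i choose t + x_i)`. -/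
def cliqueUnion {n s : ℕ} (t : ℕ) (x : Fin s → ℕ) (Y : Fin s → Finset (Fin n)) :
    Finset (Finset (Fin n)) :=
  Finset.univ.biUnion fun i => Finset.powersetCard (t + x i) (Y i)

/-- The data of a union of `s` `t`-intersecting cliques: `0 ≤ x_i ≤ k - t`, `|Y_i| = t + 2 x_i`. -/
def IsCliqueSystem {n s : ℕ} (k t : ℕ) (x : Fin s → ℕ) (Y : Fin s → Finset (Fin n)) : Prop :=
  ∀ i, t + x i ≤ k ∧ (Y i).card = t + 2 * x i

/-- The sizes `|A[K]|`, for `A = ([n] choose k)` and `K` a union of `s` `t`-intersecting cliques. -/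
def cliqueSizes (n k s t : ℕ) : Set ℕ :=
  {N | ∃ (x : Fin s → ℕ) (Y : Fin s → Finset (Fin n)), IsCliqueSystem k t x Y ∧
    N = (restrict (ambient n k) (cliqueUnion t x Y)).card}

/-- The same sizes, only for pairwise disjoint supports `Y_1, …, Y_s`. -/
def disjointCliqueSizes (n k s t : ℕ) : Set ℕ :=
  {N | ∃ (x : Fin s → ℕ) (Y : Fin s → Finset (Fin n)), IsCliqueSystem k t x Y ∧
    (∀ i j, i ≠ j → Disjoint (Y i) (Y j)) ∧
    N = (restrict (ambient n k) (cliqueUnion t x Y)).card}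

/-- `h(n, k, s, t) = max |A[K]|` over all unions `K` of `s` `t`-intersecting cliques.
It is a genuine maximum for `t ≤ k ≤ n` (`extremalSize_isGreatest`), and it is attained on
pairwise disjoint supports as soon as these fit into `[n]` (`extremalSize_eq_disjoint`).
For `k < t` there is no such `K`, and the value is `0`. -/
noncomputable def extremalSize (n k s t : ℕ) : ℕ :=
  sSup (cliqueSizes n k s t)

lemma bddAbove_cliqueSizes (n k s t : ℕ) : BddAbove (cliqueSizes n k s t) := by
  refine ⟨(ambient n k).card, ?_⟩
  rintro N ⟨x, Y, -, rfl⟩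
  exact Finset.card_le_card (Finset.filter_subset _ _)

lemma extremalSize_isGreatest {n k s t : ℕ} (htk : t ≤ k) (hkn : k ≤ n) :
    IsGreatest (cliqueSizes n k s t) (extremalSize n k s t) := by
  refine ⟨Nat.sSup_mem ?_ (bddAbove_cliqueSizes n k s t), fun N hN =>
    le_csSup (bddAbove_cliqueSizes n k s t) hN⟩
  obtain ⟨T, -, hT⟩ := Finset.exists_subset_card_eq
    (s := (Finset.univ : Finset (Fin n))) (n := t) (by simpa using htk.trans hkn)
  exact ⟨_, fun _ => 0, fun _ => T, fun _ => ⟨by simpa using htk, by simpa using hT⟩, rfl⟩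

lemma mem_restrict_cliqueUnion {n k s t : ℕ} {x : Fin s → ℕ} {Y : Fin s → Finset (Fin n)}
    {B : Finset (Fin n)} :
    B ∈ restrict (ambient n k) (cliqueUnion t x Y) ↔
      B.card = k ∧ ∃ i, t + x i ≤ (B ∩ Y i).card := by
  simp only [restrict, ambient, cliqueUnion, Finset.mem_filter, Finset.mem_powersetCard,
    Finset.subset_univ, true_and, Finset.mem_biUnion, Finset.mem_univ]
  refine and_congr_right fun _ => ⟨?_, ?_⟩
  · rintro ⟨A, ⟨i, hAY, hA⟩, hAB⟩
    exact ⟨i, hA ▸ Finset.card_le_card (Finset.subset_inter hAB hAY)⟩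
  · rintro ⟨i, hi⟩
    obtain ⟨A, hA, hc⟩ := Finset.exists_subset_card_eq hi
    exact ⟨A, ⟨i, hA.trans Finset.inter_subset_right, hc⟩, hA.trans Finset.inter_subset_left⟩

/-- Replacing a point `a` of one support by a point `b` outside all supports does not decrease
the size of `A[K]`. -/
lemma card_restrict_le_update {n k s t : ℕ} (x : Fin s → ℕ) (Y : Fin s → Finset (Fin n))
    (p : Fin s) (a b : Fin n) (ha : a ∈ Y p) (hb : ∀ i, b ∉ Y i) :
    (restrict (ambient n k) (cliqueUnion t x Y)).card ≤
      (restrict (ambient n k)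
        (cliqueUnion t x (Function.update Y p (insert b ((Y p).erase a))))).card := by
  set Z := Function.update Y p (insert b ((Y p).erase a)) with hZ
  have hZp : Z p = insert b ((Y p).erase a) := by simp [hZ]
  have hZi : ∀ i, i ≠ p → Z i = Y i := fun i hi => by simp [hZ, hi]
  rw [← Finset.card_sdiff_le_card_sdiff_iff]
  have hab : a ≠ b := fun h => hb p (h ▸ ha)
  have key : ∀ B ∈ restrict (ambient n k) (cliqueUnion t x Y) \
      restrict (ambient n k) (cliqueUnion t x Z), a ∈ B ∧ b ∉ B ∧ B.card = k ∧
        t + x p ≤ (B ∩ Y p).card ∧ (B ∩ Z p).card < t + x p ∧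
        ∀ i, i ≠ p → (B ∩ Y i).card < t + x i := by
    intro B hB
    rw [Finset.mem_sdiff, mem_restrict_cliqueUnion, mem_restrict_cliqueUnion] at hB
    obtain ⟨⟨hk, i, hi⟩, h2⟩ := hB
    have h3 : ∀ j, (B ∩ Z j).card < t + x j := fun j => by
      by_contra hj
      exact h2 ⟨hk, j, not_lt.mp hj⟩
    have hip : i = p := by
      by_contra hne
      have := h3 i
      rw [hZi i hne] at this
      omega
    subst hip
    have h4 : ¬ (B ∩ Y i).card ≤ (B ∩ Z i).card := by have := h3 i; omega
    have haB : a ∈ B := by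
      by_contra haB
      apply h4
      apply Finset.card_le_card
      intro y hy
      rw [Finset.mem_inter] at hy ⊢
      refine ⟨hy.1, ?_⟩
      rw [hZp, Finset.mem_insert, Finset.mem_erase]
      exact Or.inr ⟨fun h => haB (h ▸ hy.1), hy.2⟩
    refine ⟨haB, ?_, hk, hi, h3 i, fun j hj => by have := h3 j; rwa [hZi j hj] at this⟩
    intro hbB
    apply h4
    have e : B ∩ Z i = insert b ((B ∩ Y i).erase a) := by
      ext y
      simp only [hZp, Finset.mem_inter, Finset.mem_insert, Finset.mem_erase]
      constructor
      · tauto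
      · rintro (rfl | h)
        · exact ⟨hbB, Or.inl rfl⟩
        · tauto
    have hnb : b ∉ (B ∩ Y i).erase a := fun h =>
      hb i (Finset.mem_inter.mp (Finset.mem_of_mem_erase h)).2
    rw [e, Finset.card_insert_of_notMem hnb,
      Finset.card_erase_of_mem (Finset.mem_inter.mpr ⟨haB, ha⟩)]
    omega
  refine Finset.card_le_card_of_injOn (fun B => insert b (B.erase a)) ?_ ?_
  · intro B hB
    obtain ⟨haB, hbB, hk, h1, h2, h3⟩ := key B (Finset.mem_coe.mp hB)
    have hnb : b ∉ B.erase a := fun h => hbB (Finset.mem_of_mem_erase h)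
    rw [Finset.mem_coe, Finset.mem_sdiff, mem_restrict_cliqueUnion, mem_restrict_cliqueUnion]
    refine ⟨⟨?_, p, ?_⟩, ?_⟩
    · rw [Finset.card_insert_of_notMem hnb, Finset.card_erase_of_mem haB]
      have := Finset.card_pos.mpr ⟨a, haB⟩
      omega
    · have e : insert b (B.erase a) ∩ Z p = insert b ((B ∩ Y p).erase a) := by
        ext y
        simp only [hZp, Finset.mem_inter, Finset.mem_insert, Finset.mem_erase]
        tauto
      have hnb2 : b ∉ (B ∩ Y p).erase a := fun h =>
        hbB (Finset.mem_inter.mp (Finset.mem_of_mem_erase h)).1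
      rw [e, Finset.card_insert_of_notMem hnb2,
        Finset.card_erase_of_mem (Finset.mem_inter.mpr ⟨haB, ha⟩)]
      omega
    · rintro ⟨-, i, hi⟩
      beta_reduce at hi
      by_cases hip : i = p
      · subst hip
        have : (insert b (B.erase a) ∩ Y i).card ≤ (B ∩ Z i).card := by
          apply Finset.card_le_card
          intro y hy
          simp only [hZp, Finset.mem_inter, Finset.mem_insert, Finset.mem_erase] at hy ⊢
          rcases hy with ⟨rfl | h, h'⟩
          · exact absurd h' (hb i)
          · exact ⟨h.2, Or.inr ⟨h.1, h'⟩⟩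
        omega
      · have : (insert b (B.erase a) ∩ Y i).card ≤ (B ∩ Y i).card := by
          apply Finset.card_le_card
          intro y hy
          simp only [Finset.mem_inter, Finset.mem_insert, Finset.mem_erase] at hy ⊢
          rcases hy with ⟨rfl | h, h'⟩
          · exact absurd h' (hb i)
          · exact ⟨h.2, h'⟩
        have := h3 i hip
        omega
  · intro B hB D hD h
    obtain ⟨haB, hbB, -⟩ := key B (Finset.mem_coe.mp hB)
    obtain ⟨haD, hbD, -⟩ := key D (Finset.mem_coe.mp hD)
    ext y
    have hy := Finset.ext_iff.mp h y
    simp only [Finset.mem_insert, Finset.mem_erase] at hy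
    by_cases hya : y = a
    · subst hya; tauto
    · by_cases hyb : y = b
      · subst hyb; tauto
      · tauto

/-- A union of cliques whose supports fit disjointly into `[n]` is dominated by one, with cliques
of the same sizes, whose supports are pairwise disjoint. -/
lemma exists_disjoint_ge {n k s t : ℕ} (x : Fin s → ℕ) (Y : Fin s → Finset (Fin n))
    (hY : IsCliqueSystem k t x Y) (hroom : ∑ i, (t + 2 * x i) ≤ n) :
    ∃ Z : Fin s → Finset (Fin n), IsCliqueSystem k t x Z ∧
      (∀ i j, i ≠ j → Disjoint (Z i) (Z j)) ∧
      (restrict (ambient n k) (cliqueUnion t x Y)).card ≤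
        (restrict (ambient n k) (cliqueUnion t x Z)).card := by
  induction hd : n - (Finset.univ.biUnion Y).card using Nat.strong_induction_on generalizing Y with
  | _ d ih =>
    by_cases hdis : ∀ i j, i ≠ j → Disjoint (Y i) (Y j)
    · exact ⟨Y, hY, hdis, le_rfl⟩
    push Not at hdis
    obtain ⟨p, q, hpq, hnd⟩ := hdis
    obtain ⟨a, hap, haq⟩ := Finset.not_disjoint_iff.mp hnd
    have hlt : (Finset.univ.biUnion Y).card < n := by
      have hsub : Finset.univ.biUnion Y ⊆
          (Finset.univ.erase p).biUnion Y ∪ (Y p).erase a := by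
        intro y hy
        obtain ⟨i, -, hi⟩ := Finset.mem_biUnion.mp hy
        rw [Finset.mem_union, Finset.mem_biUnion]
        by_cases hya : y = a
        · exact Or.inl ⟨q, by simp [hpq.symm], hya ▸ haq⟩
        by_cases hip : i = p
        · exact Or.inr (Finset.mem_erase.mpr ⟨hya, hip ▸ hi⟩)
        · exact Or.inl ⟨i, by simp [hip], hi⟩
      have h1 := Finset.card_le_card hsub
      have h2 := Finset.card_union_le ((Finset.univ.erase p).biUnion Y) ((Y p).erase a)
      have h3 : ((Finset.univ.erase p).biUnion Y).card ≤ ∑ i ∈ Finset.univ.erase p, (Y i).card :=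
        Finset.card_biUnion_le
      have h4 := Finset.card_erase_of_mem hap
      have h5 := Finset.card_pos.mpr ⟨a, hap⟩
      have h6 := Finset.sum_erase_add Finset.univ (fun i => (Y i).card) (Finset.mem_univ p)
      have h7 : ∑ i, (Y i).card = ∑ i, (t + 2 * x i) :=
        Finset.sum_congr rfl fun i _ => (hY i).2
      omega
    obtain ⟨b, hb⟩ : ∃ b, b ∉ Finset.univ.biUnion Y := by
      by_contra hcon
      push Not at hcon
      rw [Finset.eq_univ_iff_forall.mpr hcon] at hlt
      simp at hlt
    have hb' : ∀ i, b ∉ Y i := fun i hi =>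
      hb (Finset.mem_biUnion.mpr ⟨i, Finset.mem_univ i, hi⟩)
    set Z := Function.update Y p (insert b ((Y p).erase a)) with hZ
    have hZp : Z p = insert b ((Y p).erase a) := by simp [hZ]
    have hZi : ∀ i, i ≠ p → Z i = Y i := fun i hi => by simp [hZ, hi]
    have hZsys : IsCliqueSystem k t x Z := by
      intro i
      refine ⟨(hY i).1, ?_⟩
      by_cases hip : i = p
      · subst hip
        have h5 := Finset.card_pos.mpr ⟨a, hap⟩
        rw [hZp, Finset.card_insert_of_notMem
          (fun h => hb' i (Finset.mem_of_mem_erase h)), Finset.card_erase_of_mem hap, ← (hY i).2]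
        omega
      · rw [hZi i hip]; exact (hY i).2
    have hgrow : (Finset.univ.biUnion Y).card < (Finset.univ.biUnion Z).card := by
      have hsub : insert b (Finset.univ.biUnion Y) ⊆ Finset.univ.biUnion Z := by
        intro y hy
        rw [Finset.mem_insert] at hy
        rw [Finset.mem_biUnion]
        rcases hy with rfl | hy
        · exact ⟨p, Finset.mem_univ p, by simp [hZp]⟩
        · obtain ⟨i, -, hi⟩ := Finset.mem_biUnion.mp hy
          by_cases hya : y = a
          · exact ⟨q, Finset.mem_univ q, by rw [hZi q hpq.symm, hya]; exact haq⟩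
          by_cases hip : i = p
          · exact ⟨p, Finset.mem_univ p, by subst hip; simp [hZp, hya, hi]⟩
          · exact ⟨i, Finset.mem_univ i, by rw [hZi i hip]; exact hi⟩
      have := Finset.card_le_card hsub
      rw [Finset.card_insert_of_notMem hb] at this
      omega
    obtain ⟨W, hW1, hW2, hW3⟩ := ih _ (by omega) Z hZsys rfl
    exact ⟨W, hW1, hW2, (card_restrict_le_update x Y p a b hap hb').trans hW3⟩

/-- If `n ≥ s (2k - t)`, so that all supports under consideration fit disjointly into `[n]`, then
`h(n, k, s, t)` is the maximum of `|A[K]|` over unions of cliques with pairwise disjoint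
supports. -/
lemma extremalSize_eq_disjoint {n k s t : ℕ} (hroom : s * (2 * k - t) ≤ n) :
    extremalSize n k s t = sSup (disjointCliqueSizes n k s t) := by
  have hsub : disjointCliqueSizes n k s t ⊆ cliqueSizes n k s t := by
    rintro N ⟨x, Y, h1, -, h3⟩
    exact ⟨x, Y, h1, h3⟩
  have hbdd : BddAbove (disjointCliqueSizes n k s t) := (bddAbove_cliqueSizes n k s t).mono hsub
  have hdom : ∀ N ∈ cliqueSizes n k s t, ∃ M ∈ disjointCliqueSizes n k s t, N ≤ M := by
    rintro N ⟨x, Y, hY, rfl⟩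
    have hsum : ∑ i, (t + 2 * x i) ≤ n := by
      refine le_trans ?_ hroom
      calc ∑ i, (t + 2 * x i) ≤ ∑ _i : Fin s, (2 * k - t) :=
            Finset.sum_le_sum fun i _ => by have := (hY i).1; omega
        _ = s * (2 * k - t) := by simp
    obtain ⟨Z, h1, h2, h3⟩ := exists_disjoint_ge x Y hY hsum
    exact ⟨_, ⟨x, Z, h1, h2, rfl⟩, h3⟩
  rcases (cliqueSizes n k s t).eq_empty_or_nonempty with he | hne
  · have he' : disjointCliqueSizes n k s t = ∅ := Set.subset_eq_empty hsub he
    rw [extremalSize, he, he']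
  · apply le_antisymm
    · refine csSup_le hne fun N hN => ?_
      obtain ⟨M, hM, hle⟩ := hdom N hN
      exact hle.trans (le_csSup hbdd hM)
    · obtain ⟨N, hN⟩ := hne
      obtain ⟨M, hM, -⟩ := hdom N hN
      exact csSup_le_csSup (bddAbove_cliqueSizes n k s t) ⟨M, hM⟩ hsub

end HajnalRothschild

namespace HajnalRothschild

section

open Finset

/-! Write h₁ for h(n,k,1,t). The family S is compressed by two moves that keep track of everything
it generates. Shrinking: a member is replaced by a proper subset of size at least t whenever this
creates no t-matching of size r + 1. Splitting: if more than a 1/(200ℓ) part of some clique lies in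
S, all members containing a set of that clique are set aside. The bound on the matching number then
drops by one, since each remaining set meets few sets of the clique in t points
(`not_hasMatching_sdiff_clique`). When neither move applies, S is covered by s - r cliques L and an
irreducible family T without t-matchings of size r + 1 (`exists_irreducible`). If r = 0, then T is
empty and L is the required system.

Suppose r ≥ 1. Since T cannot be shrunk, it is spread: a set of size at least t has at most (2ℓr)^ρ
extensions by ρ points in T (`card_extensions_le`). Compare T with a maximum t-matching. A member of
size t + d either meets two matching members in t points, which spreadness makes rare, or lies in
one of at most r t-intersecting families. Such a family lies in a single clique, of which T contains
little, up to an exceptional part that is again small by spreadness (`card_layer_le`). Counting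
supersets, T generates at most 0.06 r h₁ sets (`Irreducible.card_restrict_le`).

On the other hand, cliques generate so sparse a part of all k-sets that r extremal ones can be added
to L almost without overlap. Hence h(n,k,s,t) is at least |A[L]| + 0.99 r h₁
(`listFamily_add_le_extremalSize_of_card`). Thus |A[S]| ≤ h(n,k,s,t) - 0.93 h₁, whereas the
hypothesis demands more than h(n,k,s,t) - 0.6 h₁. -/

/-! ### Matchings -/

lemma not_hasMatching_succ_of_matchingNumber_le {n t s : ℕ} {S : Finset (Finset (Fin n))}
    (h : matchingNumber S t ≤ s) : ¬ HasMatching S t (s + 1) := by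
  intro hm
  have h1 : ((s + 1 : ℕ) : ℕ∞) ≤ matchingNumber S t :=
    le_iSup (fun m : {m : ℕ // HasMatching S t m} => (m.1 : ℕ∞)) ⟨s + 1, hm⟩
  have h2 := h1.trans h
  rw [Nat.cast_le] at h2
  omega

lemma hasMatching_zero {n : ℕ} (S : Finset (Finset (Fin n))) (t : ℕ) : HasMatching S t 0 :=
  ⟨Fin.elim0, fun i => i.elim0, fun i => i.elim0⟩

/-- A `t`-matching can be extended by a set meeting each of its members in fewer than `t` points. -/
lemma hasMatching_cons {n t m : ℕ} {S : Finset (Finset (Fin n))} {f : Fin m → Finset (Fin n)}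
    (hf : ∀ i, f i ∈ S) (hff : ∀ i j, i ≠ j → (f i ∩ f j).card < t)
    {D : Finset (Fin n)} (hD : D ∈ S) (hDf : ∀ i, (D ∩ f i).card < t) :
    HasMatching S t (m + 1) := by
  refine ⟨Fin.cons D f, fun i => ?_, fun i j => ?_⟩
  · refine Fin.cases ?_ (fun i => ?_) i
    · simpa using hD
    · simpa using hf i
  · refine Fin.cases ?_ (fun i => ?_) i <;> refine Fin.cases ?_ (fun j => ?_) j
    · simp
    · intro _; simpa using hDf j
    · intro _; simpa [inter_comm] using hDf i
    · intro hij
      simpa using hff i j (fun h => hij (by rw [h]))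

lemma le_card_of_not_hasMatching {n t m : ℕ} {S : Finset (Finset (Fin n))}
    (h : ¬ HasMatching S t m) {A : Finset (Fin n)} (hA : A ∈ S) : t ≤ A.card := by
  by_contra hlt
  exact h ⟨fun _ => A, fun _ => hA, fun _ _ _ => by simpa using hlt⟩

lemma HasMatching.mono {n t m : ℕ} {S S' : Finset (Finset (Fin n))} (h : S ⊆ S')
    (hS : HasMatching S t m) : HasMatching S' t m :=
  let ⟨f, hf, hff⟩ := hS
  ⟨f, fun i => h (hf i), hff⟩

lemma exists_maximum_matching {n t r : ℕ} {S : Finset (Finset (Fin n))}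
    (hS : ¬ HasMatching S t (r + 1)) :
    ∃ m ≤ r, HasMatching S t m ∧ ¬ HasMatching S t (m + 1) := by
  induction r with
  | zero => exact ⟨0, le_rfl, hasMatching_zero S t, hS⟩
  | succ r ih =>
    by_cases h : HasMatching S t (r + 1)
    · exact ⟨r + 1, le_rfl, h, hS⟩
    · obtain ⟨m, hm, h1⟩ := ih h
      exact ⟨m, by omega, h1⟩

/-! ### Rich cliques and the reduction to an irreducible family -/

/-- A set that contains no member of the clique `(Y choose t + x)` meets only few members of this
clique in `t` or more points. -/
lemma card_clique_meeting_le {n t x : ℕ} {Y E : Finset (Fin n)} (hY : Y.card = t + 2 * x)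
    (hE : (E ∩ Y).card < t + x) :
    ((powersetCard (t + x) Y).filter fun G => t ≤ (G ∩ E).card).card ≤
      (x + 1) * (t + 2 * x - 1).choose (t + x) := by
  have h1 : x + 1 ≤ (Y \ E).card := by
    have := card_sdiff_add_card_inter Y E
    rw [inter_comm] at this
    omega
  -- A set of size t + x with t points in E has at most x points outside E, so it misses a point of
  -- N.
  obtain ⟨N, hNY, hN⟩ := exists_subset_card_eq h1
  have hsub : ((powersetCard (t + x) Y).filter fun G => t ≤ (G ∩ E).card) ⊆
      N.biUnion fun v => powersetCard (t + x) (Y.erase v) := by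
    intro G hG
    rw [mem_filter, mem_powersetCard] at hG
    obtain ⟨⟨hGY, hGc⟩, hGE⟩ := hG
    by_contra hcon
    have hNG : N ⊆ G := by
      intro v hv
      by_contra hvG
      apply hcon
      rw [mem_biUnion]
      refine ⟨v, hv, mem_powersetCard.mpr ⟨fun y hy => ?_, hGc⟩⟩
      exact mem_erase.mpr ⟨fun h => hvG (h ▸ hy), hGY hy⟩
    have h2 : Disjoint (G ∩ E) N := by
      rw [disjoint_left]
      intro y hy hyN
      exact (mem_sdiff.mp (hNY hyN)).2 (mem_inter.mp hy).2
    have h3 : (G ∩ E ∪ N).card ≤ G.card :=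
      card_le_card (union_subset inter_subset_left hNG)
    rw [card_union_of_disjoint h2] at h3
    omega
  refine (card_le_card hsub).trans ?_
  rw [← hN]
  refine card_biUnion_le_card_mul _ _ _ fun v hv => ?_
  rw [card_powersetCard, card_erase_of_mem (mem_sdiff.mp (hNY hv)).1, hY]

/-- A family without `t`-matchings of size `r + 1` that cannot be simplified: no member can be
replaced by a proper subset, and no clique contains a substantial part of the family. -/
structure Irreducible {n : ℕ} (T : Finset (Finset (Fin n))) (t r ℓ : ℕ) : Prop where
  card_le : ∀ A ∈ T, A.card ≤ t + ℓ
  no_matching : ¬ HasMatching T t (r + 1)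
  replace : ∀ D ∈ T, ∀ Q, Q ⊂ D → t ≤ Q.card → HasMatching (insert Q (T.erase D)) t (r + 1)
  poor : ∀ x ≤ ℓ, ∀ Y : Finset (Fin n), Y.card = t + 2 * x →
    200 * ℓ * (T ∩ powersetCard (t + x) Y).card ≤ (t + 2 * x).choose x

/-- Removing a rich clique decreases the matching number. -/
lemma not_hasMatching_sdiff_clique {n t r ℓ x : ℕ} (htl : 400 * ℓ ^ 3 * (r + 1) ≤ t) (hx : x ≤ ℓ)
    {S : Finset (Finset (Fin n))} (hS : ¬ HasMatching S t (r + 2))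
    {Y : Finset (Fin n)} (hY : Y.card = t + 2 * x)
    (hrich : (t + 2 * x).choose x < 200 * ℓ * (S ∩ powersetCard (t + x) Y).card) :
    ¬ HasMatching (S.filter fun A => (A ∩ Y).card < t + x) t (r + 1) := by
  rintro ⟨f, hf, hff⟩
  simp only [mem_filter] at hf
  -- Otherwise D would extend the matching f to one of size r + 2 in S.
  have hkill : ∀ D ∈ S ∩ powersetCard (t + x) Y, ∃ i, t ≤ (D ∩ f i).card := by
    intro D hD
    by_contra! hcon
    exact hS (hasMatching_cons (fun i => (hf i).1) hff (mem_inter.mp hD).1 hcon)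
  have hsub : S ∩ powersetCard (t + x) Y ⊆ (univ : Finset (Fin (r + 1))).biUnion fun i =>
      (powersetCard (t + x) Y).filter fun G => t ≤ (G ∩ f i).card := by
    intro D hD
    obtain ⟨i, hi⟩ := hkill D hD
    exact mem_biUnion.mpr ⟨i, mem_univ i, mem_filter.mpr ⟨(mem_inter.mp hD).2, hi⟩⟩
  have h1 : (S ∩ powersetCard (t + x) Y).card ≤
      (r + 1) * ((x + 1) * (t + 2 * x - 1).choose (t + x)) := by
    have := (card_le_card hsub).trans
      (card_biUnion_le_card_mul _ _ _ fun i _ => card_clique_meeting_le hY (hf i).2)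
    simpa using this
  rcases Nat.eq_zero_or_pos x with rfl | hxpos
  · rcases Nat.eq_zero_or_pos t with rfl | ht
    · have : ℓ = 0 := by
        by_contra h0
        have : 0 < 400 * ℓ ^ 3 * (r + 1) := by positivity
        omega
      subst this
      simp at hrich
    · have : (t + 2 * 0 - 1).choose (t + 0) = 0 := Nat.choose_eq_zero_of_lt (by omega)
      rw [this] at h1
      simp at h1
      simp [h1] at hrich
  · have h2 : (t + 2 * x - 1).choose (t + x) * (t + 2 * x) = (t + 2 * x).choose x * x := by
      have h := Nat.choose_mul_succ_eq (t + 2 * x - 1) (t + x)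
      rw [show t + 2 * x - 1 + 1 = t + 2 * x by omega,
        show t + 2 * x - (t + x) = x by omega,
        ← Nat.choose_symm (show t + x ≤ t + 2 * x by omega),
        show t + 2 * x - (t + x) = x by omega] at h
      exact h
    -- The fraction of the clique met by r + 1 sets is at most (r + 1)(x + 1)x/(t + 2x). This is
    -- where t ≥ 400ℓ³s enters: it makes the fraction at most 1/(200ℓ).
    have h3 : 200 * ℓ * ((r + 1) * ((x + 1) * x)) ≤ t + 2 * x := by
      calc 200 * ℓ * ((r + 1) * ((x + 1) * x)) ≤ 200 * ℓ * ((r + 1) * ((ℓ + ℓ) * ℓ)) := by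
            gcongr; omega
        _ = 400 * ℓ ^ 3 * (r + 1) := by ring
        _ ≤ t + 2 * x := by omega
    have h4 : (t + 2 * x).choose x * (t + 2 * x) < (t + 2 * x) * (t + 2 * x).choose x := by
      calc (t + 2 * x).choose x * (t + 2 * x)
          < 200 * ℓ * (S ∩ powersetCard (t + x) Y).card * (t + 2 * x) := by
            exact Nat.mul_lt_mul_of_pos_right hrich (by omega)
        _ ≤ 200 * ℓ * ((r + 1) * ((x + 1) * (t + 2 * x - 1).choose (t + x))) * (t + 2 * x) := by
            gcongr
        _ = 200 * ℓ * ((r + 1) * (x + 1)) * ((t + 2 * x - 1).choose (t + x) * (t + 2 * x)) := by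
            ring
        _ = 200 * ℓ * ((r + 1) * ((x + 1) * x)) * (t + 2 * x).choose x := by rw [h2]; ring
        _ ≤ (t + 2 * x) * (t + 2 * x).choose x := by gcongr
    rw [mul_comm] at h4
    exact lt_irrefl _ h4

/-- Every family without `t`-matchings of size `r + 1` is covered by some cliques and an
irreducible family. -/
theorem exists_irreducible {n t ℓ : ℕ} (ht : 1 ≤ t) (r : ℕ) (htl : 400 * ℓ ^ 3 * r ≤ t)
    (S : Finset (Finset (Fin n))) (hS : ∀ A ∈ S, A.card ≤ t + ℓ)
    (hSm : ¬ HasMatching S t (r + 1)) :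
    ∃ (L : List (ℕ × Finset (Fin n))) (m : ℕ) (T : Finset (Finset (Fin n))),
      L.length + m = r ∧ (∀ c ∈ L, c.1 ≤ ℓ ∧ c.2.card = t + 2 * c.1) ∧ Irreducible T t m ℓ ∧
      ∀ A ∈ S, (∃ c ∈ L, t + c.1 ≤ (A ∩ c.2).card) ∨ ∃ D ∈ T, D ⊆ A := by
  -- Both moves decrease the total size of the members.
  induction hN : ∑ A ∈ S, A.card using Nat.strong_induction_on generalizing S r with
  | _ N ih =>
    by_cases hrep : ∃ D ∈ S, ∃ Q, Q ⊂ D ∧ t ≤ Q.card ∧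
        ¬ HasMatching (insert Q (S.erase D)) t (r + 1)
    · obtain ⟨D, hD, Q, hQD, htQ, hQm⟩ := hrep
      have hcard := card_lt_card hQD
      have hsum : ∑ A ∈ insert Q (S.erase D), A.card < N := by
        have h1 : ∑ A ∈ insert Q (S.erase D), A.card ≤ Q.card + ∑ A ∈ S.erase D, A.card := by
          by_cases hmem : Q ∈ S.erase D
          · rw [insert_eq_of_mem hmem]; omega
          · rw [sum_insert hmem]
        have h2 : D.card + ∑ A ∈ S.erase D, A.card = ∑ A ∈ S, A.card := add_sum_erase S _ hD
        omega
      obtain ⟨L, m, T, h1, h2, h3, h4⟩ := ih _ hsum r htl (insert Q (S.erase D)) (by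
        intro A hA
        rw [mem_insert] at hA
        rcases hA with rfl | hA
        · exact hcard.le.trans (hS D hD)
        · exact hS A (mem_of_mem_erase hA)) hQm rfl
      refine ⟨L, m, T, h1, h2, h3, fun A hA => ?_⟩
      by_cases hAD : A = D
      · subst hAD
        rcases h4 Q (mem_insert_self _ _) with ⟨c, hc, hcA⟩ | ⟨E, hE, hEQ⟩
        · exact Or.inl ⟨c, hc, hcA.trans (card_le_card (inter_subset_inter_right hQD.1))⟩
        · exact Or.inr ⟨E, hE, hEQ.trans hQD.1⟩
      · exact h4 A (mem_insert_of_mem (mem_erase.mpr ⟨hAD, hA⟩))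
    by_cases hpoor : ∃ x ≤ ℓ, ∃ Y : Finset (Fin n), Y.card = t + 2 * x ∧
        (t + 2 * x).choose x < 200 * ℓ * (S ∩ powersetCard (t + x) Y).card
    · obtain ⟨x, hx, Y, hY, hrich⟩ := hpoor
      have hne : (S ∩ powersetCard (t + x) Y).Nonempty := by
        rw [← card_pos]
        exact Nat.pos_of_ne_zero fun h => by simp [h] at hrich
      obtain ⟨D, hD⟩ := hne
      rw [mem_inter, mem_powersetCard] at hD
      -- A single set is already a matching of size 1, so r = 0 would force S to be empty.
      obtain ⟨q, rfl⟩ : ∃ q, r = q + 1 := by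
        refine Nat.exists_eq_succ_of_ne_zero fun h => ?_
        subst h
        exact hSm (hasMatching_cons (f := Fin.elim0) (fun i => i.elim0) (fun i => i.elim0) hD.1
          (fun i => i.elim0))
      have hnm := not_hasMatching_sdiff_clique htl hx hSm hY hrich
      have hsum : ∑ A ∈ S.filter (fun A => (A ∩ Y).card < t + x), A.card < N := by
        rw [← hN]
        refine sum_lt_sum_of_subset (filter_subset _ _) hD.1 ?_ ?_ (fun _ _ _ => Nat.zero_le _)
        · rw [mem_filter, inter_eq_left.mpr hD.2.1, hD.2.2]
          simp
        · rw [hD.2.2]; omega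
      obtain ⟨L, m, T, h1, h2, h3, h4⟩ := ih _ hsum q
        ((Nat.mul_le_mul_left _ (Nat.le_succ q)).trans htl) _
        (fun A hA => hS A (mem_filter.mp hA).1) hnm rfl
      refine ⟨(x, Y) :: L, m, T, by simp; omega, ?_, h3, fun A hA => ?_⟩
      · intro c hc
        rw [List.mem_cons] at hc
        rcases hc with rfl | hc
        · exact ⟨hx, hY⟩
        · exact h2 c hc
      · by_cases hAY : (A ∩ Y).card < t + x
        · rcases h4 A (mem_filter.mpr ⟨hA, hAY⟩) with ⟨c, hc, hcA⟩ | h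
          · exact Or.inl ⟨c, List.mem_cons_of_mem _ hc, hcA⟩
          · exact Or.inr h
        · exact Or.inl ⟨(x, Y), List.mem_cons_self, not_lt.mp hAY⟩
    · push Not at hrep hpoor
      exact ⟨[], r, S, by simp, by simp, ⟨hS, hSm, hrep, hpoor⟩,
        fun A hA => Or.inr ⟨A, hA, Subset.rfl⟩⟩

/-! ### Spreadness of irreducible families -/

namespace Irreducible

variable {n t r ℓ : ℕ} {T : Finset (Finset (Fin n))}

/-- The matching created by replacing D with Q must use Q, and only once because |Q| ≥ t. Its other
r members are the E i; they block every D' ⊇ Q in T, since otherwise D' in place of Q would give a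
matching of size r + 1 in T. -/
lemma exists_meeting (hT : Irreducible T t r ℓ) {Q D : Finset (Fin n)} (hD : D ∈ T) (hQD : Q ⊂ D)
    (htQ : t ≤ Q.card) :
    ∃ E : Fin r → Finset (Fin n), (∀ i, E i ∈ T ∧ (Q ∩ E i).card < t) ∧
      ∀ D' ∈ T, Q ⊆ D' → ∃ i, t ≤ (D' ∩ E i).card := by
  obtain ⟨f, hf, hff⟩ := hT.replace D hD Q hQD htQ
  have hex : ∃ i₀, f i₀ = Q := by
    by_contra! hcon
    refine hT.no_matching ⟨f, fun i => ?_, hff⟩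
    exact mem_of_mem_erase (mem_of_mem_insert_of_ne (hf i) (hcon i))
  obtain ⟨i₀, hi₀⟩ := hex
  have hne : ∀ i, i ≠ i₀ → (Q ∩ f i).card < t := fun i hi => hi₀ ▸ hff i₀ i hi.symm
  have hmem : ∀ i, i ≠ i₀ → f i ∈ T := fun i hi => by
    refine mem_of_mem_erase (mem_of_mem_insert_of_ne (hf i) fun h => ?_)
    have := hne i hi
    rw [h, inter_self] at this
    omega
  refine ⟨fun i => f (i₀.succAbove i), fun i => ⟨hmem _ (Fin.succAbove_ne _ _),
    hne _ (Fin.succAbove_ne _ _)⟩, fun D' hD' hQD' => ?_⟩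
  by_contra! hcon
  exact hT.no_matching (hasMatching_cons (fun i => hmem _ (Fin.succAbove_ne _ _))
    (fun i j hij => hff _ _ fun h => hij (Fin.succAbove_right_injective h)) hD' hcon)

/-- The number of members of an irreducible family that extend a given set by `ρ` points. -/
lemma card_extensions_le (hT : Irreducible T t r ℓ) {ρ : ℕ} (hρ : ρ ≤ ℓ) {Q : Finset (Fin n)}
    (htQ : t ≤ Q.card) :
    (T.filter fun D => Q ⊆ D ∧ D.card = Q.card + ρ).card ≤ (2 * ℓ * r) ^ ρ := by
  induction ρ generalizing Q with
  | zero =>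
    rw [pow_zero, card_le_one]
    intro D hD D' hD'
    rw [mem_filter] at hD hD'
    rw [← eq_of_subset_of_card_le hD.2.1 hD.2.2.le, ← eq_of_subset_of_card_le hD'.2.1 hD'.2.2.le]
  | succ ρ ih =>
    rcases (T.filter fun D => Q ⊆ D ∧ D.card = Q.card + (ρ + 1)).eq_empty_or_nonempty with he | hne
    · rw [he]; simp
    obtain ⟨D, hD⟩ := hne
    rw [mem_filter] at hD
    have hQD : Q ⊂ D := ⟨hD.2.1, fun h => by have := card_le_card h; omega⟩
    obtain ⟨E, hE, hmeet⟩ := hT.exists_meeting hD.1 hQD htQ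
    -- Each D' contains a point e of some E i outside Q, because D' meets E i in t points and Q does
    -- not. Adding at most ℓ points to Q reaches t, so |Q ∩ E i| ≥ t - ℓ and E i has at most 2ℓ
    -- points outside Q. This leaves at most 2ℓr choices of (i, e).
    have hsub : (T.filter fun D => Q ⊆ D ∧ D.card = Q.card + (ρ + 1)) ⊆
        ((univ : Finset (Fin r)).filter fun i => (E i \ Q).card ≤ 2 * ℓ).biUnion fun i =>
          (E i \ Q).biUnion fun e =>
            T.filter fun D => insert e Q ⊆ D ∧ D.card = (insert e Q).card + ρ := by
      intro D' hD'
      rw [mem_filter] at hD'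
      obtain ⟨hD'T, hQD', hc⟩ := hD'
      obtain ⟨i, hi⟩ := hmeet D' hD'T hQD'
      have h1 : (D' ∩ E i).card ≤ (Q ∩ E i).card + (D' \ Q).card := by
        rw [← card_union_of_disjoint
          (disjoint_sdiff.mono_left inter_subset_left)]
        refine card_le_card fun y hy => ?_
        simp only [mem_union, mem_inter, mem_sdiff] at hy ⊢
        tauto
      have h2 := card_sdiff_add_card_eq_card hQD'
      have h3 := card_sdiff_add_card_inter (E i) Q
      rw [inter_comm] at h3
      have h4 := hT.card_le _ (hE i).1
      obtain ⟨e, he, heQ⟩ : ∃ e ∈ D' ∩ E i, e ∉ Q := by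
        by_contra! hcon
        have := card_le_card (show D' ∩ E i ⊆ Q ∩ E i from
          fun y hy => mem_inter.mpr ⟨hcon y hy, (mem_inter.mp hy).2⟩)
        have := (hE i).2
        omega
      rw [mem_inter] at he
      refine mem_biUnion.mpr ⟨i, mem_filter.mpr ⟨mem_univ i, by omega⟩,
        mem_biUnion.mpr ⟨e, mem_sdiff.mpr ⟨he.2, heQ⟩, mem_filter.mpr ⟨hD'T, ?_, ?_⟩⟩⟩
      · exact insert_subset he.1 hQD'
      · rw [card_insert_of_notMem heQ]; omega
    calc _ ≤ _ := card_le_card hsub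
      _ ≤ ((univ : Finset (Fin r)).filter fun i => (E i \ Q).card ≤ 2 * ℓ).card *
            (2 * ℓ * (2 * ℓ * r) ^ ρ) := by
          refine card_biUnion_le_card_mul _ _ _ fun i hi => ?_
          refine (card_biUnion_le_card_mul _ _ _ fun e he => ih (by omega) ?_).trans
            (Nat.mul_le_mul_right _ (mem_filter.mp hi).2)
          exact htQ.trans (card_le_card (subset_insert _ _))
      _ ≤ r * (2 * ℓ * (2 * ℓ * r) ^ ρ) := by
          gcongr
          exact (card_filter_le _ _).trans (by simp)
      _ = (2 * ℓ * r) ^ (ρ + 1) := by ring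

/-- The number of members that meet both `A` and `B` in at least `|A ∩ B| + G` points and miss
exactly `z` points of `A ∩ B`. -/
lemma card_meeting_two_le (hT : Irreducible T t r ℓ) {A B : Finset (Fin n)} {d z G : ℕ}
    (hd : d ≤ ℓ) (htz : t ≤ (A ∩ B).card + z + 2 * G) :
    (T.filter fun D => D.card = t + d ∧ (A ∩ B).card + G ≤ (D ∩ A).card ∧
      (A ∩ B).card + G ≤ (D ∩ B).card ∧ ((A ∩ B) \ D).card = z).card ≤
      (A ∩ B).card.choose z * ((A \ B).card.choose (z + G) * (B \ A).card.choose (z + G)) *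
        (2 * ℓ * r) ^ (t + d - ((A ∩ B).card + z + 2 * G)) := by
  have hsub : (T.filter fun D => D.card = t + d ∧ (A ∩ B).card + G ≤ (D ∩ A).card ∧
      (A ∩ B).card + G ≤ (D ∩ B).card ∧ ((A ∩ B) \ D).card = z) ⊆
      (powersetCard z (A ∩ B) ×ˢ
        (powersetCard (z + G) (A \ B) ×ˢ powersetCard (z + G) (B \ A))).biUnion fun p =>
        T.filter fun D => (A ∩ B) \ p.1 ∪ (p.2.1 ∪ p.2.2) ⊆ D ∧ D.card = t + d := by
    intro D hD
    rw [mem_filter] at hD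
    obtain ⟨hDT, hDc, hDA, hDB, hz⟩ := hD
    have h0 := card_sdiff_add_card_inter (A ∩ B) D
    have h1 : (D ∩ A).card = ((A ∩ B) ∩ D).card + (D ∩ (A \ B)).card := by
      rw [← card_union_of_disjoint]
      · congr 1; ext y; simp only [mem_union, mem_inter, mem_sdiff]; tauto
      · rw [disjoint_left]; intro y; simp only [mem_inter, mem_sdiff]; tauto
    have h2 : (D ∩ B).card = ((A ∩ B) ∩ D).card + (D ∩ (B \ A)).card := by
      rw [← card_union_of_disjoint]
      · congr 1; ext y; simp only [mem_union, mem_inter, mem_sdiff]; tauto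
      · rw [disjoint_left]; intro y; simp only [mem_inter, mem_sdiff]; tauto
    -- Missing z points of A ∩ B must be compensated by z + G points in each of A \ B and B \ A.
    -- Together with the rest of A ∩ B, these form a set Q of size |A ∩ B| + z + 2G, to which the
    -- extension bound applies.
    obtain ⟨P, hP, hPc⟩ := exists_subset_card_eq (show z + G ≤ (D ∩ (A \ B)).card by omega)
    obtain ⟨R, hR, hRc⟩ := exists_subset_card_eq (show z + G ≤ (D ∩ (B \ A)).card by omega)
    refine mem_biUnion.mpr ⟨((A ∩ B) \ D, P, R), ?_, mem_filter.mpr ⟨hDT, ?_, hDc⟩⟩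
    · simp only [mem_product, mem_powersetCard]
      exact ⟨⟨sdiff_subset, hz⟩, ⟨hP.trans inter_subset_right, hPc⟩,
        ⟨hR.trans inter_subset_right, hRc⟩⟩
    · refine union_subset ?_ (union_subset (hP.trans inter_subset_left)
        (hR.trans inter_subset_left))
      intro y hy
      simp only [mem_sdiff, mem_inter] at hy
      tauto
  refine (card_le_card hsub).trans ((card_biUnion_le_card_mul _ _
    ((2 * ℓ * r) ^ (t + d - ((A ∩ B).card + z + 2 * G))) ?_).trans (le_of_eq ?_))
  · rintro ⟨Z, P, R⟩ hp
    simp only [mem_product, mem_powersetCard] at hp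
    obtain ⟨⟨hZ, hZc⟩, ⟨hP, hPc⟩, hR, hRc⟩ := hp
    have hQ : ((A ∩ B) \ Z ∪ (P ∪ R)).card = (A ∩ B).card + z + 2 * G := by
      have e1 : Disjoint P R := by
        rw [disjoint_left]; intro y hy hy'
        exact (mem_sdiff.mp (hP hy)).2 (mem_sdiff.mp (hR hy')).1
      have e2 : Disjoint ((A ∩ B) \ Z) (P ∪ R) := by
        rw [disjoint_left]; intro y hy hy'
        rw [mem_sdiff, mem_inter] at hy
        rcases mem_union.mp hy' with h | h
        · exact (mem_sdiff.mp (hP h)).2 hy.1.2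
        · exact (mem_sdiff.mp (hR h)).2 hy.1.1
      rw [card_union_of_disjoint e2, card_union_of_disjoint e1, card_sdiff_of_subset hZ]
      have := card_le_card hZ
      omega
    dsimp only
    by_cases hle : (A ∩ B).card + z + 2 * G ≤ t + d
    · have hmain := hT.card_extensions_le (ρ := t + d - ((A ∩ B).card + z + 2 * G))
        (Q := (A ∩ B) \ Z ∪ (P ∪ R)) (by omega) (by omega)
      rw [hQ, Nat.add_sub_cancel' hle] at hmain
      exact hmain
    · rw [filter_false_of_mem]
      · simp
      · rintro D - ⟨h1, h2⟩
        have := card_le_card h1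
        omega
  · simp only [card_product, card_powersetCard]

end Irreducible

/-! ### Layers of an irreducible family -/

/-- The contribution of the sets of size `t + d` that do not fill up a common clique. -/
def layerBound (t r ℓ d : ℕ) : ℕ :=
  ∑ z ∈ range d, (t + ℓ).choose z * (8 * ℓ ^ 3 * r) ^ (d - z)

lemma card_inter_add_le {n G : ℕ} {A B D : Finset (Fin n)} (hA : (A ∩ B).card + G ≤ (D ∩ A).card)
    (hB : (A ∩ B).card + G ≤ (D ∩ B).card) :
    (A ∩ B).card + ((A ∩ B) \ D).card + 2 * G ≤ (D ∩ (A ∪ B)).card := by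
  have h0 := card_sdiff_add_card_inter (A ∩ B) D
  have h1 := card_union_add_card_inter (D ∩ A) (D ∩ B)
  rw [← inter_union_distrib_left, ← inter_inter_distrib_left, inter_comm D (A ∩ B)] at h1
  omega

lemma choose_le_pow_sub {a b m : ℕ} (hab : a ≤ b) (hbm : b ≤ m) :
    b.choose a ≤ m ^ (b - a) := by
  rw [← Nat.choose_symm hab]
  exact (Nat.choose_le_pow b (b - a)).trans (Nat.pow_le_pow_left hbm _)

namespace Irreducible

variable {n t r ℓ : ℕ} {T : Finset (Finset (Fin n))}

/-- Here G = t - |A ∩ B| is positive. This shortens the extension left free by at least one point,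
and the factor 2ℓr saved pays for the r on the left. The saving matters because about r² pairs are
summed later. -/
lemma card_meeting_pair_le (hT : Irreducible T t r ℓ) {d : ℕ} (hd : d ≤ ℓ) (hr : 1 ≤ r)
    {A B : Finset (Fin n)} (hA : A.card ≤ t + d) (hB : B.card ≤ t + d) (hAB : (A ∩ B).card < t) :
    r * (T.filter fun D => D.card = t + d ∧ t ≤ (D ∩ A).card ∧ t ≤ (D ∩ B).card).card ≤
      layerBound t r ℓ d := by
  obtain ⟨G, hG⟩ : ∃ G, (A ∩ B).card + G = t := ⟨t - (A ∩ B).card, by omega⟩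
  have hsub : (T.filter fun D => D.card = t + d ∧ t ≤ (D ∩ A).card ∧ t ≤ (D ∩ B).card) ⊆
      ((range d).filter fun z => z + G ≤ d).biUnion fun z =>
        T.filter fun D => D.card = t + d ∧ (A ∩ B).card + G ≤ (D ∩ A).card ∧
          (A ∩ B).card + G ≤ (D ∩ B).card ∧ ((A ∩ B) \ D).card = z := by
    intro D hD
    rw [mem_filter] at hD
    obtain ⟨hDT, hDc, hDA, hDB⟩ := hD
    have h1 := card_inter_add_le (G := G) (A := A) (B := B) (D := D) (by omega) (by omega)
    have h2 : (D ∩ (A ∪ B)).card ≤ D.card := card_le_card inter_subset_left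
    exact mem_biUnion.mpr ⟨((A ∩ B) \ D).card,
      mem_filter.mpr ⟨mem_range.mpr (by omega), by omega⟩,
      mem_filter.mpr ⟨hDT, hDc, by omega, by omega, rfl⟩⟩
  refine (Nat.mul_le_mul_left r ((card_le_card hsub).trans card_biUnion_le)).trans ?_
  rw [mul_sum, layerBound]
  refine (sum_le_sum fun z hz => ?_).trans (sum_le_sum_of_subset (filter_subset _ _))
  rw [mem_filter, mem_range] at hz
  obtain ⟨hzd, hzG⟩ := hz
  have hl : 1 ≤ ℓ := by omega
  have hAB1 := card_sdiff_add_card_inter A B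
  have hBA1 := card_sdiff_add_card_inter B A
  rw [inter_comm B A] at hBA1
  -- Two such factors and one factor 2ℓr for every free point give the base 8ℓ³r of `layerBound`.
  have hch : ∀ a, a ≤ d + G → a.choose (z + G) ≤ (2 * ℓ) ^ (d - z) := fun a ha => by
    refine (Nat.choose_le_choose _ ha).trans ?_
    rw [show d - z = d + G - (z + G) by omega]
    exact choose_le_pow_sub (by omega) (by omega)
  have hpow : r * (2 * ℓ * r) ^ (d - z - G) ≤ (2 * ℓ * r) ^ (d - z) := by
    calc r * (2 * ℓ * r) ^ (d - z - G) ≤ (2 * ℓ * r) * (2 * ℓ * r) ^ (d - z - G) := by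
          gcongr
          exact Nat.le_mul_of_pos_left _ (by omega)
      _ = (2 * ℓ * r) ^ (d - z - G + 1) := by ring
      _ ≤ (2 * ℓ * r) ^ (d - z) := Nat.pow_le_pow_right (by positivity) (by omega)
  calc _ ≤ r * ((A ∩ B).card.choose z *
          ((A \ B).card.choose (z + G) * (B \ A).card.choose (z + G)) *
          (2 * ℓ * r) ^ (t + d - ((A ∩ B).card + z + 2 * G))) :=
        Nat.mul_le_mul_left _ (hT.card_meeting_two_le hd (by omega))
    _ ≤ r * ((t + ℓ).choose z * ((2 * ℓ) ^ (d - z) * (2 * ℓ) ^ (d - z)) *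
          (2 * ℓ * r) ^ (d - z - G)) := by
        rw [show t + d - ((A ∩ B).card + z + 2 * G) = d - z - G by omega]
        gcongr
        · omega
        · exact hch _ (by omega)
        · exact hch _ (by omega)
    _ = (t + ℓ).choose z * ((2 * ℓ) ^ (d - z) * (2 * ℓ) ^ (d - z)) *
          (r * (2 * ℓ * r) ^ (d - z - G)) := by ring
    _ ≤ (t + ℓ).choose z * ((2 * ℓ) ^ (d - z) * (2 * ℓ) ^ (d - z)) * (2 * ℓ * r) ^ (d - z) := by
        gcongr
    _ = (t + ℓ).choose z * (8 * ℓ ^ 3 * r) ^ (d - z) := by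
        rw [mul_assoc, ← mul_pow, ← mul_pow]
        congr 2
        ring

/-- Take A, B in U with the smallest intersection and let z = |(A ∩ B) \ D|. If z ≥ d, then |A ∩ B|
= t and D lies in A ∪ B, a set of size t + 2d, so these D belong to one clique and `poor` applies.
The D with z < d are counted by spreadness. -/
lemma card_intersecting_le (hT : Irreducible T t r ℓ) {d : ℕ} (hd : d ≤ ℓ) (hr : 1 ≤ r)
    {U : Finset (Finset (Fin n))} (hUT : U ⊆ T) (hUc : ∀ D ∈ U, D.card = t + d)
    (hU : ∀ D ∈ U, ∀ D' ∈ U, t ≤ (D ∩ D').card) :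
    200 * ℓ * U.card ≤ 200 * ℓ * layerBound t r ℓ d + (t + 2 * d).choose d := by
  rcases U.eq_empty_or_nonempty with rfl | hne
  · simp
  obtain ⟨⟨A, B⟩, hAB, hmin⟩ := exists_min_image (U ×ˢ U) (fun p => (p.1 ∩ p.2).card)
    (hne.product hne)
  rw [mem_product] at hAB
  obtain ⟨hAU, hBU⟩ := hAB
  dsimp only at hAU hBU hmin
  have hmin' : ∀ D ∈ U, ∀ D' ∈ U, (A ∩ B).card ≤ (D ∩ D').card := fun D hD D' hD' =>
    hmin (D, D') (mem_product.mpr ⟨hD, hD'⟩)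
  have hAc := hUc A hAU
  have hBc := hUc B hBU
  have hct := hU A hAU B hBU
  have hAB1 := card_sdiff_add_card_inter A B
  have hBA1 := card_sdiff_add_card_inter B A
  rw [inter_comm B A] at hBA1
  have hkey : ∀ D ∈ U, (A ∩ B).card + ((A ∩ B) \ D).card ≤ (D ∩ (A ∪ B)).card := fun D hD =>
    card_inter_add_le (G := 0) (hmin' D hD A hAU) (hmin' D hD B hBU)
  have hpoor : 200 * ℓ * (U.filter fun D => d ≤ ((A ∩ B) \ D).card).card ≤
      (t + 2 * d).choose d := by
    rcases (U.filter fun D => d ≤ ((A ∩ B) \ D).card).eq_empty_or_nonempty with he | ⟨D, hD⟩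
    · simp [he]
    · rw [mem_filter] at hD
      have h1 := hkey D hD.1
      have h2 : (D ∩ (A ∪ B)).card ≤ D.card := card_le_card inter_subset_left
      have h3 := hUc D hD.1
      have h4 := card_union_add_card_inter A B
      refine le_trans ?_ (hT.poor d hd (A ∪ B) (by omega))
      gcongr
      intro D' hD'
      rw [mem_filter] at hD'
      have h5 := hkey D' hD'.1
      have h6 := hUc D' hD'.1
      rw [mem_inter, mem_powersetCard]
      refine ⟨hUT hD'.1, ?_, h6⟩
      rw [← inter_eq_left]
      exact eq_of_subset_of_card_le inter_subset_left (by omega)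
  have hrest : (U.filter fun D => ¬ d ≤ ((A ∩ B) \ D).card).card ≤ layerBound t r ℓ d := by
    have hsub : (U.filter fun D => ¬ d ≤ ((A ∩ B) \ D).card) ⊆ (range d).biUnion fun z =>
        T.filter fun D => D.card = t + d ∧ (A ∩ B).card + 0 ≤ (D ∩ A).card ∧
          (A ∩ B).card + 0 ≤ (D ∩ B).card ∧ ((A ∩ B) \ D).card = z := by
      intro D hD
      rw [mem_filter] at hD
      exact mem_biUnion.mpr ⟨_, mem_range.mpr (not_le.mp hD.2), mem_filter.mpr
        ⟨hUT hD.1, hUc D hD.1, hmin' D hD.1 A hAU, hmin' D hD.1 B hBU, rfl⟩⟩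
    refine ((card_le_card hsub).trans card_biUnion_le).trans (sum_le_sum fun z hz => ?_)
    rw [mem_range] at hz
    refine (hT.card_meeting_two_le hd (by omega)).trans ?_
    rw [add_zero, show (A \ B).card = t + d - (A ∩ B).card by omega,
      show (B \ A).card = t + d - (A ∩ B).card by omega]
    obtain ⟨e, he⟩ : ∃ e, t + d - (A ∩ B).card = e := ⟨_, rfl⟩
    rw [show t + d - ((A ∩ B).card + z + 2 * 0) = e - z by omega, he]
    rcases lt_or_ge e z with hez | hez
    · simp [Nat.choose_eq_zero_of_lt hez]
    have hl : 1 ≤ ℓ := by omega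
    calc _ ≤ (t + ℓ).choose z * (ℓ ^ (e - z) * ℓ ^ (e - z)) * (2 * ℓ * r) ^ (e - z) := by
          gcongr
          · omega
          · exact choose_le_pow_sub hez (by omega)
          · exact choose_le_pow_sub hez (by omega)
      _ = (t + ℓ).choose z * (2 * ℓ ^ 3 * r) ^ (e - z) := by
          rw [mul_assoc, ← mul_pow, ← mul_pow]
          congr 2
          ring
      _ ≤ (t + ℓ).choose z * (8 * ℓ ^ 3 * r) ^ (e - z) := by
          gcongr; omega
      _ ≤ (t + ℓ).choose z * (8 * ℓ ^ 3 * r) ^ (d - z) := by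
          gcongr
          · exact Nat.one_le_iff_ne_zero.mpr (by positivity)
          · omega
  have hsplit := card_filter_add_card_filter_not (s := U) (fun D => d ≤ ((A ∩ B) \ D).card)
  calc 200 * ℓ * U.card = 200 * ℓ * (U.filter fun D => d ≤ ((A ∩ B) \ D).card).card +
        200 * ℓ * (U.filter fun D => ¬ d ≤ ((A ∩ B) \ D).card).card := by
        rw [← hsplit]; ring
    _ ≤ (t + 2 * d).choose d + 200 * ℓ * layerBound t r ℓ d := by gcongr
    _ = _ := add_comm _ _

/-- The number of members of size `t + d` of an irreducible family. -/
theorem card_layer_le (hT : Irreducible T t r ℓ) {d : ℕ} (hd : d ≤ ℓ) :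
    200 * ℓ * (T.filter fun D => D.card = t + d).card ≤
      r * (400 * ℓ * layerBound t r ℓ d + (t + 2 * d).choose d) := by
  -- The matching is maximum among the members of size at most t + d: the pair estimate needs this
  -- size bound, and sets of size t + d may still be exchanged into the matching.
  obtain ⟨m, hmr, ⟨f, hf, hff⟩, hmax⟩ := exists_maximum_matching
    (S := T.filter fun D => D.card ≤ t + d) (r := r) fun h =>
      hT.no_matching (h.mono (filter_subset _ _))
  set P := fun p : Fin m × Fin m => T.filter fun D =>
    D.card = t + d ∧ t ≤ (D ∩ f p.1).card ∧ t ≤ (D ∩ f p.2).card with hP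
  set U := fun i => T.filter fun D => D.card = t + d ∧ ∀ j, j ≠ i → (D ∩ f j).card < t with hU
  have hsub : (T.filter fun D => D.card = t + d) ⊆
      (univ : Finset (Fin m)).offDiag.biUnion P ∪ univ.biUnion U := by
    intro D hD
    have hD' := mem_filter.mp hD
    obtain ⟨i, hi⟩ : ∃ i, t ≤ (D ∩ f i).card := by
      by_contra! hcon
      exact hmax (hasMatching_cons hf hff (mem_filter.mpr ⟨hD'.1, hD'.2.le⟩) hcon)
    rw [mem_union]
    by_cases hex : ∃ j, j ≠ i ∧ t ≤ (D ∩ f j).card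
    · obtain ⟨j, hji, hj⟩ := hex
      exact Or.inl (mem_biUnion.mpr ⟨(i, j), by simpa using hji.symm,
        mem_filter.mpr ⟨hD'.1, hD'.2, hi, hj⟩⟩)
    · push Not at hex
      exact Or.inr (mem_biUnion.mpr ⟨i, mem_univ i, mem_filter.mpr ⟨hD'.1, hD'.2, hex⟩⟩)
  rcases Nat.eq_zero_or_pos r with rfl | hr
  · obtain rfl : m = 0 := by omega
    have h0 : (T.filter fun D => D.card = t + d) = ∅ := by
      rw [eq_empty_iff_forall_notMem]
      intro D hD
      have := hsub hD
      simp at this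
    simp [h0]
  have hPc : ((univ : Finset (Fin m)).offDiag.biUnion P).card ≤ r * layerBound t r ℓ d := by
    have h1 : ∀ p ∈ (univ : Finset (Fin m)).offDiag, (P p).card ≤ layerBound t r ℓ d / r := by
      rintro ⟨i, j⟩ hp
      rw [mem_offDiag] at hp
      rw [Nat.le_div_iff_mul_le hr, mul_comm]
      exact hT.card_meeting_pair_le hd hr (mem_filter.mp (hf i)).2 (mem_filter.mp (hf j)).2
        (hff i j hp.2.2)
    calc _ ≤ (univ : Finset (Fin m)).offDiag.card * (layerBound t r ℓ d / r) :=
          card_biUnion_le_card_mul _ _ _ h1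
      _ ≤ (r * r) * (layerBound t r ℓ d / r) := by
          gcongr
          rw [offDiag_card, card_univ, Fintype.card_fin]
          exact (Nat.sub_le _ _).trans (Nat.mul_le_mul hmr hmr)
      _ = r * (r * (layerBound t r ℓ d / r)) := by ring
      _ ≤ r * layerBound t r ℓ d := by
          gcongr
          exact Nat.mul_div_le _ _
  have hUi : ∀ i, 200 * ℓ * (U i).card ≤ 200 * ℓ * layerBound t r ℓ d + (t + 2 * d).choose d := by
    intro i
    refine hT.card_intersecting_le hd hr (filter_subset _ _)
      (fun D hD => (mem_filter.mp hD).2.1) fun D hD D' hD' => ?_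
    rw [mem_filter] at hD hD'
    -- If D and D' met in fewer than t points, replacing f i by D' and adding D would enlarge the
    -- matching.
    by_contra! hlt
    refine hmax (hasMatching_cons (f := Function.update f i D') (D := D) (fun j => ?_)
      (fun j j' hjj' => ?_) (mem_filter.mpr ⟨hD.1, hD.2.1.le⟩) fun j => ?_)
    · by_cases hj : j = i
      · subst hj
        simpa using ⟨hD'.1, hD'.2.1.le⟩
      · rw [Function.update_of_ne hj]
        exact hf j
    · by_cases hj : j = i
      · subst hj
        rw [Function.update_self, Function.update_of_ne hjj'.symm]
        exact hD'.2.2 j' hjj'.symm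
      · rw [Function.update_of_ne hj]
        by_cases hj' : j' = i
        · subst hj'
          rw [Function.update_self, inter_comm]
          exact hD'.2.2 j hj
        · rw [Function.update_of_ne hj']
          exact hff j j' hjj'
    · by_cases hj : j = i
      · subst hj
        simpa using hlt
      · rw [Function.update_of_ne hj]
        exact hD.2.2 j hj
  calc _ ≤ 200 * ℓ * (r * layerBound t r ℓ d + ∑ i, (U i).card) := by
        gcongr
        exact (card_le_card hsub).trans ((card_union_le _ _).trans
          (add_le_add hPc card_biUnion_le))
    _ = r * (200 * ℓ * layerBound t r ℓ d) + ∑ i, 200 * ℓ * (U i).card := by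
        rw [mul_add, mul_sum]; ring
    _ ≤ r * (200 * ℓ * layerBound t r ℓ d) +
          m * (200 * ℓ * layerBound t r ℓ d + (t + 2 * d).choose d) := by
        gcongr
        refine (sum_le_sum fun i _ => hUi i).trans (le_of_eq ?_)
        simp
    _ ≤ r * (200 * ℓ * layerBound t r ℓ d) +
          r * (200 * ℓ * layerBound t r ℓ d + (t + 2 * d).choose d) := by gcongr
    _ = _ := by ring

end Irreducible

/-! ### Counting k-sets by their intersection with a fixed set -/

/-- The number of `k`-subsets of `[n]` that meet a given `a`-set in at least `b` points. -/
def meetCount (n k a b : ℕ) : ℕ :=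
  ∑ i ∈ range (k + 1), if b ≤ i then a.choose i * (n - a).choose (k - i) else 0

lemma card_ambient_inter_eq {n k i : ℕ} (hi : i ≤ k) (Y : Finset (Fin n)) :
    ((ambient n k).filter fun B => (B ∩ Y).card = i).card =
      Y.card.choose i * (n - Y.card).choose (k - i) := by
  have hc : (univ \ Y).card = n - Y.card := by
    rw [card_sdiff_of_subset (subset_univ Y), card_univ, Fintype.card_fin]
  rw [← hc, ← card_powersetCard, ← card_powersetCard, ← card_product]
  refine card_nbij' (fun B => (B ∩ Y, B \ Y)) (fun p => p.1 ∪ p.2) ?_ ?_ ?_ ?_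
  · intro B hB
    simp only [ambient, coe_filter, mem_powersetCard, subset_univ, true_and,
      Set.mem_ofPred_eq] at hB
    have := card_sdiff_add_card_inter B Y
    simp only [coe_product, Set.mem_prod, mem_coe, mem_powersetCard]
    exact ⟨⟨inter_subset_right, hB.2⟩, sdiff_subset_sdiff (subset_univ _) Subset.rfl, by omega⟩
  · rintro ⟨P, R⟩ hp
    simp only [coe_product, Set.mem_prod, mem_coe, mem_powersetCard] at hp
    obtain ⟨⟨hP, hPc⟩, hR, hRc⟩ := hp
    have hd : Disjoint P R := by
      rw [disjoint_left]; intro y hy hy'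
      exact (mem_sdiff.mp (hR hy')).2 (hP hy)
    have he : (P ∪ R) ∩ Y = P := by
      ext y
      simp only [mem_inter, mem_union]
      constructor
      · rintro ⟨h | h, hY⟩
        · exact h
        · exact absurd hY (mem_sdiff.mp (hR h)).2
      · exact fun h => ⟨Or.inl h, hP h⟩
    simp only [ambient, coe_filter, mem_powersetCard, subset_univ, true_and, Set.mem_ofPred_eq]
    rw [card_union_of_disjoint hd, he]
    exact ⟨by omega, hPc⟩
  · intro B _
    ext y
    simp only [mem_union, mem_inter, mem_sdiff]
    tauto
  · rintro ⟨P, R⟩ hp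
    simp only [coe_product, Set.mem_prod, mem_coe, mem_powersetCard] at hp
    obtain ⟨⟨hP, -⟩, hR, -⟩ := hp
    have hR' : ∀ y ∈ R, y ∉ Y := fun y hy => (mem_sdiff.mp (hR hy)).2
    refine Prod.ext ?_ ?_
    · ext y
      simp only [mem_inter, mem_union]
      have := @hP y
      have := hR' y
      tauto
    · ext y
      simp only [mem_sdiff, mem_union]
      have := @hP y
      have := hR' y
      tauto

lemma card_ambient_meeting {n k b : ℕ} (Y : Finset (Fin n)) :
    ((ambient n k).filter fun B => b ≤ (B ∩ Y).card).card = meetCount n k Y.card b := by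
  rw [meetCount, card_eq_sum_card_fiberwise (f := fun B => (B ∩ Y).card) (t := range (k + 1))]
  · refine sum_congr rfl fun i hi => ?_
    rw [mem_range] at hi
    rw [filter_filter]
    split_ifs with hbi
    · rw [← card_ambient_inter_eq (by omega) Y]
      congr 1
      refine filter_congr fun B _ => ⟨fun h => h.2, fun h => ⟨by omega, h⟩⟩
    · rw [card_eq_zero, filter_eq_empty_iff]
      intro B _
      omega
  · intro B hB
    simp only [ambient, coe_filter, mem_powersetCard, subset_univ, true_and,
      Set.mem_ofPred_eq] at hB
    have := card_le_card (inter_subset_left : B ∩ Y ⊆ B)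
    simp only [coe_range, Set.mem_Iio]
    omega

lemma card_ambient_superset {n k : ℕ} (D : Finset (Fin n)) (hD : D.card ≤ k) :
    ((ambient n k).filter fun B => D ⊆ B).card = (n - D.card).choose (k - D.card) := by
  have := card_ambient_inter_eq hD D
  rw [Nat.choose_self, one_mul] at this
  rw [← this]
  congr 1
  refine filter_congr fun B _ => ⟨fun h => by rw [inter_eq_right.mpr h], fun h => ?_⟩
  rw [← inter_eq_right]
  exact eq_of_subset_of_card_le inter_subset_right h.ge

/-- Some `a`-set `Y` is at most as correlated with `G` as the average one. -/
lemma exists_low_correlation {n k a b : ℕ} (ha : a ≤ n) {G : Finset (Finset (Fin n))}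
    (hG : G ⊆ ambient n k) :
    ∃ Y : Finset (Fin n), Y.card = a ∧
      (G.filter fun B => b ≤ (B ∩ Y).card).card * n.choose k ≤ G.card * meetCount n k a b := by
  have hcount : ∀ G' : Finset (Finset (Fin n)), G' ⊆ ambient n k →
      ∑ Y ∈ ambient n a, (G'.filter fun B => b ≤ (B ∩ Y).card).card =
        G'.card * meetCount n a k b := by
    intro G' hG'
    have h := sum_card_bipartiteAbove_eq_sum_card_bipartiteBelow
      (s := ambient n a) (t := G') (fun Y B => b ≤ (B ∩ Y).card)
    simp only [bipartiteAbove, bipartiteBelow] at h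
    rw [h, ← smul_eq_mul, ← sum_const]
    refine sum_congr rfl fun B hB => ?_
    have hBk : B.card = k := (mem_powersetCard.mp (hG' hB)).2
    rw [← hBk, ← card_ambient_meeting B]
    simp only [inter_comm]
  -- Both sides count the pairs (B, Y) of a k-set and an a-set with |B ∩ Y| ≥ b.
  have hamb : n.choose a * meetCount n k a b = n.choose k * meetCount n a k b := by
    have h := hcount (ambient n k) Subset.rfl
    have hk : (ambient n k).card = n.choose k := by simp [ambient]
    have hA : (ambient n a).card = n.choose a := by simp [ambient]
    rw [hk] at h
    rw [← h, ← hA, ← smul_eq_mul, ← sum_const]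
    refine sum_congr rfl fun Y hY => ?_
    rw [card_ambient_meeting, (mem_powersetCard.mp hY).2]
  have hne : (ambient n a).Nonempty := by
    rw [ambient, powersetCard_nonempty]
    simpa using ha
  have hle : ∑ Y ∈ ambient n a, (G.filter fun B => b ≤ (B ∩ Y).card).card * n.choose k ≤
      ∑ _Y ∈ ambient n a, G.card * meetCount n k a b := by
    rw [← sum_mul, hcount G hG, sum_const, smul_eq_mul]
    have hA : (ambient n a).card = n.choose a := by simp [ambient]
    rw [hA]
    apply le_of_eq
    calc G.card * meetCount n a k b * n.choose k
        = G.card * (n.choose k * meetCount n a k b) := by ring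
      _ = n.choose a * (G.card * meetCount n k a b) := by rw [← hamb]; ring
  obtain ⟨Y, hY, h⟩ := exists_le_of_sum_le hne hle
  exact ⟨Y, (mem_powersetCard.mp hY).2, h⟩

/-- In the Vandermonde sum for `n.choose k`, each term of index i + 1 ≥ t + x is at most
(x+1)(K-x+1)/((t+x)(u-x)) times the term of index i. Shifting the index by one therefore bounds the
upper tail by this multiple of the whole sum. -/
lemma meetCount_mul_le {n k t K u x : ℕ} (ht : 1 ≤ t) (hk : t + K = k) (hn : k + u = n)
    (ha : t + 2 * x ≤ n) :
    meetCount n k (t + 2 * x) (t + x) * ((t + x) * (u - x)) ≤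
      n.choose k * ((x + 1) * (K - x + 1)) := by
  have hV : n.choose k = ∑ i ∈ range (k + 1),
      (t + 2 * x).choose i * (n - (t + 2 * x)).choose (k - i) := by
    have h := Nat.add_choose_eq (t + 2 * x) (n - (t + 2 * x)) k
    rw [Nat.add_sub_cancel' ha, Nat.sum_antidiagonal_eq_sum_range_succ
      (fun i j => (t + 2 * x).choose i * (n - (t + 2 * x)).choose j)] at h
    exact h
  rw [hV, meetCount, sum_range_succ', if_neg (by omega), add_zero, sum_mul, sum_mul]
  refine (sum_le_sum fun i hi => ?_).trans
    (sum_le_sum_of_subset (range_subset_range.mpr (Nat.le_succ k)))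
  rw [mem_range] at hi
  split_ifs with hti
  swap
  · simp
  have h1 : (t + 2 * x).choose (i + 1) * (t + x) ≤ (t + 2 * x).choose i * (x + 1) :=
    calc _ ≤ (t + 2 * x).choose (i + 1) * (i + 1) := by gcongr
      _ = (t + 2 * x).choose i * (t + 2 * x - i) := Nat.choose_succ_right_eq _ _
      _ ≤ _ := by gcongr; omega
  have h2 : (n - (t + 2 * x)).choose (k - (i + 1)) * (u - x) ≤
      (n - (t + 2 * x)).choose (k - i) * (K - x + 1) := by
    have h := Nat.choose_succ_right_eq (n - (t + 2 * x)) (k - (i + 1))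
    rw [show k - (i + 1) + 1 = k - i by omega] at h
    calc _ ≤ (n - (t + 2 * x)).choose (k - (i + 1)) *
          (n - (t + 2 * x) - (k - (i + 1))) := Nat.mul_le_mul_left _ (by omega)
      _ = _ := h.symm
      _ ≤ _ := by gcongr; omega
  calc _ = ((t + 2 * x).choose (i + 1) * (t + x)) *
        ((n - (t + 2 * x)).choose (k - (i + 1)) * (u - x)) := by ring
    _ ≤ ((t + 2 * x).choose i * (x + 1)) *
        ((n - (t + 2 * x)).choose (k - i) * (K - x + 1)) := Nat.mul_le_mul h1 h2
    _ = _ := by ring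

lemma card_restrict_clique {n k t : ℕ} (x : Fin 1 → ℕ) (Y : Fin 1 → Finset (Fin n)) :
    (restrict (ambient n k) (cliqueUnion t x Y)).card =
      meetCount n k (Y 0).card (t + x 0) := by
  rw [← card_ambient_meeting]
  congr 1
  ext B
  rw [mem_restrict_cliqueUnion, mem_filter, ambient, mem_powersetCard]
  simp

lemma exists_extremalSize_one {n k t : ℕ} (htk : t ≤ k) (hkn : k ≤ n) :
    ∃ x, t + x ≤ k ∧ t + 2 * x ≤ n ∧
      extremalSize n k 1 t = meetCount n k (t + 2 * x) (t + x) := by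
  obtain ⟨x, Y, hxY, h⟩ := (extremalSize_isGreatest (s := 1) htk hkn).1
  refine ⟨x 0, (hxY 0).1, ?_, ?_⟩
  · rw [← (hxY 0).2]
    exact (card_le_univ _).trans (by simp)
  · rw [h, card_restrict_clique, (hxY 0).2]

lemma meetCount_le_extremalSize {n k t x : ℕ} (hx : t + x ≤ k) (hn : t + 2 * x ≤ n) :
    meetCount n k (t + 2 * x) (t + x) ≤ extremalSize n k 1 t := by
  obtain ⟨Y, -, hY⟩ := exists_subset_card_eq
    (s := (univ : Finset (Fin n))) (n := t + 2 * x) (by simpa using hn)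
  refine le_csSup (bddAbove_cliqueSizes n k 1 t)
    ⟨fun _ => x, fun _ => Y, fun _ => ⟨hx, hY⟩, ?_⟩
  rw [card_restrict_clique, hY]

/-- The extremal `t`-intersecting families are a small part of all `k`-sets. -/
lemma mul_extremalSize_one_le {n k t K u s ℓ : ℕ} (ht : 1 ≤ t) (hs : 1 ≤ s) (hl : 1 ≤ ℓ)
    (hk : t + K = k) (hn : k + u = n) (hts : 100 * s ≤ t) (hu : 1 ≤ u)
    (huK : 1000 * s * ℓ * K ≤ u) :
    100 * s * extremalSize n k 1 t ≤ n.choose k := by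
  obtain ⟨x, hxk, hxn, hx⟩ := exists_extremalSize_one (n := n) (k := k) (t := t)
    (by omega) (by omega)
  rw [hx]
  have h := meetCount_mul_le ht hk hn hxn
  have hxK : x ≤ K := by omega
  have hsK : 1000 * s * K ≤ u := le_trans (by
    calc 1000 * s * K = 1000 * s * 1 * K := by ring
      _ ≤ 1000 * s * ℓ * K := by gcongr) huK
  -- K = 0 is separate: there the smallness comes from t ≥ 100s, otherwise from u ≥ 1000sℓK.
  have hratio : 100 * s * ((x + 1) * (K - x + 1)) ≤ (t + x) * (u - x) := by
    rcases Nat.eq_zero_or_pos K with h0 | hK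
    · obtain rfl : x = 0 := by omega
      subst h0
      simpa using hts.trans (Nat.le_mul_of_pos_right t hu)
    · have h1 : 100 * s * (K - x + 1) ≤ u - x := by
        have h2 : 100 * s * (K - x + 1) ≤ 100 * s * (2 * K) := by gcongr; omega
        have h3 : K ≤ s * K := Nat.le_mul_of_pos_left K hs
        have h4 : 100 * s * (2 * K) = 200 * (s * K) := by ring
        have h5 : 1000 * s * K = 1000 * (s * K) := by ring
        omega
      calc _ = (x + 1) * (100 * s * (K - x + 1)) := by ring
        _ ≤ (t + x) * (u - x) := Nat.mul_le_mul (by omega) h1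
  have hpos : 0 < (x + 1) * (K - x + 1) := by positivity
  refine Nat.le_of_mul_le_mul_right ?_ hpos
  calc _ = meetCount n k (t + 2 * x) (t + x) * (100 * s * ((x + 1) * (K - x + 1))) := by ring
    _ ≤ meetCount n k (t + 2 * x) (t + x) * ((t + x) * (u - x)) := by gcongr
    _ ≤ _ := h

/-! ### Adding almost disjoint cliques -/

/-- The members of `([n] choose k)` that contain a member of one of the listed cliques. -/
def listFamily (n k t : ℕ) (L : List (ℕ × Finset (Fin n))) : Finset (Finset (Fin n)) :=
  (ambient n k).filter fun B => ∃ c ∈ L, t + c.1 ≤ (B ∩ c.2).card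

lemma listFamily_cons (n k t : ℕ) (c : ℕ × Finset (Fin n)) (L : List (ℕ × Finset (Fin n))) :
    listFamily n k t (c :: L) =
      ((ambient n k).filter fun B => t + c.1 ≤ (B ∩ c.2).card) ∪ listFamily n k t L := by
  ext B
  simp only [listFamily, mem_filter, List.mem_cons, mem_union, exists_eq_or_imp]
  tauto

lemma card_listFamily_le {n k t : ℕ} (L : List (ℕ × Finset (Fin n)))
    (hL : ∀ c ∈ L, t + c.1 ≤ k ∧ c.2.card = t + 2 * c.1) :
    (listFamily n k t L).card ≤ L.length * extremalSize n k 1 t := by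
  induction L with
  | nil => simp [listFamily]
  | cons c L ih =>
    rw [listFamily_cons, List.length_cons, add_mul, one_mul, add_comm (_ * _)]
    refine (card_union_le _ _).trans
      (add_le_add ?_ (ih fun c hc => hL c (List.mem_cons_of_mem _ hc)))
    obtain ⟨h1, h2⟩ := hL c List.mem_cons_self
    rw [card_ambient_meeting, h2]
    refine meetCount_le_extremalSize h1 ?_
    rw [← h2]
    exact (card_le_univ _).trans (by simp)

lemma card_listFamily_le_extremalSize {n k t : ℕ} (L : List (ℕ × Finset (Fin n)))
    (hL : ∀ c ∈ L, t + c.1 ≤ k ∧ c.2.card = t + 2 * c.1) :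
    (listFamily n k t L).card ≤ extremalSize n k L.length t := by
  refine le_csSup (bddAbove_cliqueSizes n k L.length t)
    ⟨fun i => (L.get i).1, fun i => (L.get i).2, fun i => hL _ (List.get_mem L i), ?_⟩
  congr 1
  ext B
  rw [mem_restrict_cliqueUnion, listFamily, mem_filter, ambient, mem_powersetCard]
  simp only [subset_univ, true_and, List.mem_iff_get]
  refine and_congr_right fun _ => ⟨?_, ?_⟩
  · rintro ⟨c, ⟨i, rfl⟩, h⟩
    exact ⟨i, h⟩
  · rintro ⟨i, h⟩
    exact ⟨_, ⟨i, rfl⟩, h⟩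

/-- A list of fewer than `s` cliques can be extended by a clique that is almost disjoint from the
others and of maximum size. -/
lemma exists_cons_listFamily {n k t s : ℕ} (hs : 1 ≤ s) (htk : t ≤ k) (hkn : k ≤ n)
    (hsmall : 100 * s * extremalSize n k 1 t ≤ n.choose k) (L : List (ℕ × Finset (Fin n)))
    (hL : ∀ c ∈ L, t + c.1 ≤ k ∧ c.2.card = t + 2 * c.1) (hLs : L.length ≤ s) :
    ∃ c : ℕ × Finset (Fin n), (t + c.1 ≤ k ∧ c.2.card = t + 2 * c.1) ∧
      100 * (listFamily n k t L).card + 99 * extremalSize n k 1 t ≤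
        100 * (listFamily n k t (c :: L)).card := by
  obtain ⟨x, hxk, hxn, hx⟩ := exists_extremalSize_one (n := n) htk hkn
  obtain ⟨Y, hY, hcor⟩ := exists_low_correlation (k := k) (b := t + x) hxn
    (G := listFamily n k t L) (filter_subset _ _)
  refine ⟨(x, Y), ⟨hxk, hY⟩, ?_⟩
  have hcard := card_listFamily_le L hL
  have hC := card_ambient_meeting (k := k) (b := t + x) Y
  rw [hY, ← hx] at hC
  rw [← hx] at hcor
  rw [listFamily_cons]
  have hui := card_union_add_card_inter
    ((ambient n k).filter fun B => t + x ≤ (B ∩ Y).card) (listFamily n k t L)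
  have hint : ((ambient n k).filter fun B => t + x ≤ (B ∩ Y).card) ∩ listFamily n k t L =
      (listFamily n k t L).filter fun B => t + x ≤ (B ∩ Y).card := by
    ext B
    simp only [listFamily, mem_inter, mem_filter]
    tauto
  rw [hint, hC] at hui
  dsimp only
  generalize extremalSize n k 1 t = H at *
  rcases Nat.eq_zero_or_pos H with rfl | hH
  · simp only [Nat.mul_zero, Nat.add_zero]
    gcongr
    exact subset_union_right
  -- The family of L has at most sH members and the new clique has density at most 1/(100s), so the
  -- overlap is at most H/100.
  have hlow : 100 * ((listFamily n k t L).filter fun B => t + x ≤ (B ∩ Y).card).card ≤ H := by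
    refine Nat.le_of_mul_le_mul_right (c := s * H) ?_ (by positivity)
    calc _ = ((listFamily n k t L).filter fun B => t + x ≤ (B ∩ Y).card).card * (100 * s * H) := by
          ring
      _ ≤ ((listFamily n k t L).filter fun B => t + x ≤ (B ∩ Y).card).card * n.choose k := by
          gcongr
      _ ≤ (listFamily n k t L).card * H := hcor
      _ ≤ (s * H) * H := by gcongr; exact hcard.trans (by gcongr)
      _ = H * (s * H) := by ring
  omega

lemma listFamily_add_le_extremalSize {n k t s r : ℕ} (hs : 1 ≤ s) (htk : t ≤ k) (hkn : k ≤ n)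
    (hsmall : 100 * s * extremalSize n k 1 t ≤ n.choose k) (L : List (ℕ × Finset (Fin n)))
    (hL : ∀ c ∈ L, t + c.1 ≤ k ∧ c.2.card = t + 2 * c.1) (hLs : L.length + r = s) :
    100 * (listFamily n k t L).card + 99 * (r * extremalSize n k 1 t) ≤
      100 * extremalSize n k s t := by
  induction r generalizing L with
  | zero =>
    have := card_listFamily_le_extremalSize L hL
    rw [show L.length = s by omega] at this
    omega
  | succ r ih =>
    obtain ⟨c, hc, h⟩ := exists_cons_listFamily hs htk hkn hsmall L hL (by omega)
    have := ih (c :: L) (by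
      intro c' hc'
      rw [List.mem_cons] at hc'
      rcases hc' with rfl | hc'
      · exact hc
      · exact hL c' hc') (by simp; omega)
    rw [add_mul, one_mul]
    omega

/-- The same bound for cliques whose members may be too large to lie in a `k`-set. -/
lemma listFamily_add_le_extremalSize_of_card {n k t s r : ℕ} (hs : 1 ≤ s) (htk : t ≤ k)
    (hkn : k ≤ n) (hsmall : 100 * s * extremalSize n k 1 t ≤ n.choose k)
    (L : List (ℕ × Finset (Fin n))) (hL : ∀ c ∈ L, c.2.card = t + 2 * c.1)
    (hLs : L.length + r = s) :
    100 * (listFamily n k t L).card + 99 * (r * extremalSize n k 1 t) ≤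
      100 * extremalSize n k s t := by
  obtain ⟨Y, -, hY⟩ := exists_subset_card_eq
    (s := (univ : Finset (Fin n))) (n := t) (by simpa using htk.trans hkn)
  -- A clique whose members exceed size k generates nothing, so it may be replaced by the one-member
  -- clique on a t-set Y.
  set g : ℕ × Finset (Fin n) → ℕ × Finset (Fin n) := fun c => if t + c.1 ≤ k then c else (0, Y)
    with hg
  have hsub : listFamily n k t L ⊆ listFamily n k t (L.map g) := by
    intro B hB
    rw [listFamily, mem_filter] at hB ⊢
    obtain ⟨hBk, c, hc, hcB⟩ := hB
    refine ⟨hBk, c, List.mem_map.mpr ⟨c, hc, if_pos (hcB.trans ?_)⟩, hcB⟩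
    rw [← (mem_powersetCard.mp hBk).2]
    exact card_le_card inter_subset_left
  refine le_trans ?_
    (listFamily_add_le_extremalSize (r := r) hs htk hkn hsmall (L.map g) ?_ (by simpa))
  · gcongr
  · intro c hc
    obtain ⟨c', hc', rfl⟩ := List.mem_map.mp hc
    by_cases h : t + c'.1 ≤ k
    · simp only [hg, if_pos h]
      exact ⟨h, hL c' hc'⟩
    · simp only [hg, if_neg h]
      exact ⟨by simpa using htk, by simpa using hY⟩

/-! ### Binomial estimates and the weight of an irreducible family -/

/-- A Bernoulli inequality: by Pascal's rule, each of the x points removed from the ground set loses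
at most a y/M part of `M.choose y`. -/
lemma mul_choose_le_add {M x y : ℕ} (hx : x ≤ M) :
    M * M.choose y ≤ M * (M - x).choose y + x * y * M.choose y := by
  induction x with
  | zero => simp
  | succ x ih =>
    refine (ih (by omega)).trans ?_
    rcases y with _ | y
    · simp
    obtain ⟨M, rfl⟩ : ∃ M', M = M' + 1 := ⟨M - 1, by omega⟩
    have h1 : (M + 1 - x).choose (y + 1) =
        (M + 1 - (x + 1)).choose y + (M + 1 - (x + 1)).choose (y + 1) := by
      rw [show M + 1 - x = M + 1 - (x + 1) + 1 by omega, Nat.choose_succ_succ']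
    have h2 : (M + 1) * (M + 1 - (x + 1)).choose y ≤ (y + 1) * (M + 1).choose (y + 1) := by
      rw [mul_comm (y + 1), ← Nat.add_one_mul_choose_eq]
      gcongr
      omega
    rw [h1]
    nlinarith

lemma choose_le_two_mul_choose_sub {M x y : ℕ} (h : 2 * x * y ≤ M) :
    M.choose y ≤ 2 * (M - x).choose y := by
  rcases Nat.eq_zero_or_pos y with rfl | hy
  · simp
  rcases Nat.eq_zero_or_pos M with rfl | hM
  · rw [Nat.choose_eq_zero_of_lt hy]; omega
  have hxM : x ≤ M := by nlinarith
  have h1 := mul_choose_le_add (y := y) hxM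
  have h2 : 2 * x * y * M.choose y ≤ M * M.choose y := Nat.mul_le_mul_right _ h
  refine Nat.le_of_mul_le_mul_left ?_ hM
  nlinarith

/-- The left side counts the members of a clique with their k-supersets. The k-sets meeting the
support in exactly t + x points have N - 2x in place of N - x, which costs a factor of at most 2. -/
lemma clique_weight_le {n k t K N x : ℕ} (hk : t + K = k) (hn : t + N = n) (hx : x ≤ K)
    (hxN : t + 2 * x ≤ n) (h : 2 * x * (K - x) ≤ N - x) :
    (t + 2 * x).choose x * (N - x).choose (K - x) ≤ 2 * extremalSize n k 1 t := by
  have h1 := meetCount_le_extremalSize (n := n) (k := k) (t := t) (x := x) (by omega) hxN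
  have h2 : (t + 2 * x).choose (t + x) * (n - (t + 2 * x)).choose (k - (t + x)) ≤
      meetCount n k (t + 2 * x) (t + x) := by
    have := single_le_sum (f := fun i => if t + x ≤ i then
        (t + 2 * x).choose i * (n - (t + 2 * x)).choose (k - i) else 0)
      (fun _ _ => Nat.zero_le _) (mem_range.mpr (show t + x < k + 1 by omega))
    simpa [meetCount] using this
  rw [show n - (t + 2 * x) = N - x - x by omega, show k - (t + x) = K - x by omega,
    ← Nat.choose_symm (by omega), show t + 2 * x - (t + x) = x by omega] at h2
  calc _ ≤ (t + 2 * x).choose x * (2 * (N - x - x).choose (K - x)) := by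
        gcongr
        exact choose_le_two_mul_choose_sub h
    _ = 2 * ((t + 2 * x).choose x * (N - x - x).choose (K - x)) := by ring
    _ ≤ _ := by gcongr; exact h2.trans h1

lemma sum_pow_sub_le {q : ℝ} (h0 : 0 ≤ q) (h1 : q ≤ 1 / 2) (d : ℕ) :
    ∑ z ∈ range d, q ^ (d - z) ≤ 2 * q := by
  induction d with
  | zero => simpa using h0
  | succ d ih =>
    rw [sum_range_succ]
    have : ∑ z ∈ range d, q ^ (d + 1 - z) = q * ∑ z ∈ range d, q ^ (d - z) := by
      rw [mul_sum]
      refine sum_congr rfl fun z hz => ?_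
      rw [mem_range] at hz
      rw [show d + 1 - z = d - z + 1 by omega, pow_succ, mul_comm]
    rw [this, show d + 1 - d = 1 by omega, pow_one]
    nlinarith

lemma layerBound_mul_le {t r ℓ d : ℕ} {q W H : ℝ} (h0 : 0 ≤ q) (h1 : q ≤ 1 / 2) (hH : 0 ≤ H)
    (h : ∀ z < d, ((t + ℓ).choose z : ℝ) * (8 * ℓ ^ 3 * r) ^ (d - z) * W ≤ 4 * H * q ^ (d - z)) :
    (layerBound t r ℓ d : ℝ) * W ≤ 8 * H * q := by
  rw [layerBound]
  push_cast
  rw [sum_mul]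
  calc _ ≤ ∑ z ∈ range d, 4 * H * q ^ (d - z) := sum_le_sum fun z hz => h z (mem_range.mp hz)
    _ = 4 * H * ∑ z ∈ range d, q ^ (d - z) := by rw [mul_sum]
    _ ≤ 4 * H * (2 * q) := by gcongr; exact sum_pow_sub_le h0 h1 d
    _ = _ := by ring

lemma choose_sub_mul_pow_le {N K z e : ℕ} (hKN : K ≤ N) (hze : z + e ≤ K) :
    (N - (z + e)).choose (K - (z + e)) * N ^ e ≤ K ^ e * (N - z).choose (K - z) := by
  induction e with
  | zero => simp
  | succ e ih =>
    have h := ih (by omega)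
    have h1 := Nat.add_one_mul_choose_eq (N - (z + (e + 1))) (K - (z + (e + 1)))
    rw [show N - (z + (e + 1)) + 1 = N - (z + e) by omega,
      show K - (z + (e + 1)) + 1 = K - (z + e) by omega] at h1
    have h2 : N * (K - (z + e)) ≤ K * (N - (z + e)) := by
      rw [Nat.mul_sub, Nat.mul_sub, mul_comm K N]
      exact Nat.sub_le_sub_left (Nat.mul_le_mul_right _ hKN) _
    have h3 : (N - (z + (e + 1))).choose (K - (z + (e + 1))) * N ≤
        K * (N - (z + e)).choose (K - (z + e)) := by
      refine Nat.le_of_mul_le_mul_left (c := N - (z + e)) ?_ (by omega)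
      calc _ = N * ((N - (z + e)) * (N - (z + (e + 1))).choose (K - (z + (e + 1)))) := by ring
        _ = N * (K - (z + e)) * (N - (z + e)).choose (K - (z + e)) := by rw [h1]; ring
        _ ≤ K * (N - (z + e)) * (N - (z + e)).choose (K - (z + e)) := by gcongr
        _ = _ := by ring
    calc _ = (N - (z + (e + 1))).choose (K - (z + (e + 1))) * N * N ^ e := by ring
      _ ≤ K * (N - (z + e)).choose (K - (z + e)) * N ^ e := by gcongr
      _ = K * ((N - (z + e)).choose (K - (z + e)) * N ^ e) := by ring
      _ ≤ K * (K ^ e * (N - z).choose (K - z)) := by gcongr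
      _ = _ := by ring

lemma choose_mul_pow_le {t ℓ z e : ℕ} (hze : z + e ≤ ℓ) (ht : 2 * ℓ ≤ t) :
    t.choose z * t ^ e ≤ (2 * ℓ) ^ e * t.choose (z + e) := by
  induction e with
  | zero => simp
  | succ e ih =>
    have h := ih (by omega)
    have h1 := Nat.choose_succ_right_eq t (z + e)
    have h2 : t.choose (z + e) * t ≤ 2 * ℓ * t.choose (z + (e + 1)) := by
      calc t.choose (z + e) * t ≤ t.choose (z + e) * (2 * (t - (z + e))) := by gcongr; omega
        _ = 2 * (t.choose (z + e) * (t - (z + e))) := by ring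
        _ = 2 * (t.choose (z + (e + 1)) * (z + e + 1)) := by rw [← h1]; rfl
        _ ≤ 2 * (t.choose (z + (e + 1)) * ℓ) := by gcongr; omega
        _ = _ := by ring
    calc _ = t.choose z * t ^ e * t := by ring
      _ ≤ (2 * ℓ) ^ e * t.choose (z + e) * t := by gcongr
      _ = (2 * ℓ) ^ e * (t.choose (z + e) * t) := by ring
      _ ≤ (2 * ℓ) ^ e * (2 * ℓ * t.choose (z + (e + 1))) := by gcongr
      _ = _ := by ring

/-- The sets outside of common cliques contribute little to every layer. -/
lemma layerBound_weight_le {t r s ℓ K N H d : ℕ} (hl : 1 ≤ ℓ) (hrs : r ≤ s)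
    (hts : 400 * ℓ ^ 3 * s ≤ t) (hs : 1 ≤ s) (hKN : K ≤ N) (hd : d ≤ min ℓ K) (hd1 : 1 ≤ d)
    (hbig : 20000 * s * ℓ ^ 4 * K ≤ t + N)
    (hH : ∀ x ≤ min ℓ K, (t + 2 * x).choose x * (N - x).choose (K - x) ≤ 2 * H) :
    50 * (min ℓ K * (layerBound t r ℓ d * (N - d).choose (K - d))) ≤ H := by
  have hK : 1 ≤ K := by omega
  have hl3 : ℓ * ℓ ≤ ℓ ^ 3 * s := by
    calc ℓ * ℓ = ℓ ^ 2 * 1 := by ring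
      _ ≤ ℓ ^ 3 * s := Nat.mul_le_mul (Nat.pow_le_pow_right hl (by norm_num)) hs
  have htl : 400 * (ℓ * ℓ) ≤ t := by nlinarith
  have hll : ℓ ≤ ℓ * ℓ := Nat.le_mul_self ℓ
  have hch : ∀ z ≤ ℓ, (t + ℓ).choose z ≤ 2 * t.choose z := fun z hz => by
    have := choose_le_two_mul_choose_sub (M := t + ℓ) (x := ℓ) (y := z) (by nlinarith)
    rwa [Nat.add_sub_cancel] at this
  have hH' : ∀ x ≤ min ℓ K, t.choose x * (N - x).choose (K - x) ≤ 2 * H := fun x hx =>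
    le_trans (Nat.mul_le_mul_right _ (Nat.choose_le_choose _ (by omega))) (hH x hx)
  have hrK : 10000 * (ℓ ^ 4 * r * K) * 2 ≤ t + N := by
    calc 10000 * (ℓ ^ 4 * r * K) * 2 ≤ 10000 * (ℓ ^ 4 * s * K) * 2 := by gcongr
      _ = 20000 * s * ℓ ^ 4 * K := by ring
      _ ≤ _ := hbig
  -- The sum in `layerBound` is dominated by a geometric series of ratio q. If t ≤ N, then N ≥ n/2;
  -- the term z is compared with a clique of parameter z, and each further point costs K/N. If t >
  -- N, then t ≥ n/2; the comparison is with parameter d, and each point costs 2ℓ/t. The bound on n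
  -- makes q min(ℓ, K) ≤ 1/625 in both cases.
  have key : ∃ q : ℝ, 0 ≤ q ∧ q * (625 * (min ℓ K : ℕ)) ≤ 1 ∧
      ∀ z < d, ((t + ℓ).choose z : ℝ) * (8 * ℓ ^ 3 * r) ^ (d - z) *
        ((N - d).choose (K - d) : ℕ) ≤ 4 * H * q ^ (d - z) := by
    rcases le_or_gt t N with htN | htN
    · have hN : (0 : ℝ) < N := by exact_mod_cast (by omega : 0 < N)
      refine ⟨8 * ℓ ^ 3 * r * K / N, by positivity, ?_, fun z hz => ?_⟩
      · rw [div_mul_eq_mul_div, div_le_one hN]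
        have h1 : 8 * ℓ ^ 3 * r * K * (625 * min ℓ K) ≤ N := by
          calc 8 * ℓ ^ 3 * r * K * (625 * min ℓ K) ≤ 8 * ℓ ^ 3 * r * K * (625 * ℓ) := by
                gcongr; exact min_le_left _ _
            _ = 5000 * (ℓ ^ 4 * r * K) := by ring
            _ ≤ N := by omega
        exact_mod_cast h1
      · obtain ⟨e, rfl⟩ : ∃ e, d = z + e := ⟨d - z, by omega⟩
        rw [Nat.add_sub_cancel_left, div_pow, mul_div_assoc', le_div_iff₀ (by positivity)]
        have h1 := choose_sub_mul_pow_le (N := N) (K := K) (z := z) (e := e) hKN (by omega)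
        have h2 : (t + ℓ).choose z * (N - z).choose (K - z) ≤ 4 * H :=
          calc _ ≤ 2 * t.choose z * (N - z).choose (K - z) := by gcongr; exact hch z (by omega)
            _ = 2 * (t.choose z * (N - z).choose (K - z)) := by ring
            _ ≤ 2 * (2 * H) := Nat.mul_le_mul_left _ (hH' z (by omega))
            _ = 4 * H := by ring
        have h3 : (t + ℓ).choose z * (8 * ℓ ^ 3 * r) ^ e * (N - (z + e)).choose (K - (z + e)) *
            N ^ e ≤ 4 * H * (8 * ℓ ^ 3 * r * K) ^ e :=
          calc _ = (t + ℓ).choose z * (8 * ℓ ^ 3 * r) ^ e *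
                ((N - (z + e)).choose (K - (z + e)) * N ^ e) := by ring
            _ ≤ (t + ℓ).choose z * (8 * ℓ ^ 3 * r) ^ e * (K ^ e * (N - z).choose (K - z)) := by
                gcongr
            _ = (t + ℓ).choose z * (N - z).choose (K - z) * ((8 * ℓ ^ 3 * r) ^ e * K ^ e) := by
                ring
            _ ≤ 4 * H * ((8 * ℓ ^ 3 * r) ^ e * K ^ e) := by gcongr
            _ = _ := by rw [← mul_pow]
        exact_mod_cast h3
    · have ht : (0 : ℝ) < t := by exact_mod_cast (by omega : 0 < t)
      refine ⟨16 * ℓ ^ 4 * r / t, by positivity, ?_, fun z hz => ?_⟩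
      · rw [div_mul_eq_mul_div, div_le_one ht]
        have h1 : 16 * ℓ ^ 4 * r * (625 * min ℓ K) ≤ t := by
          calc 16 * ℓ ^ 4 * r * (625 * min ℓ K) ≤ 16 * ℓ ^ 4 * r * (625 * K) := by
                gcongr; exact min_le_right _ _
            _ = 10000 * (ℓ ^ 4 * r * K) := by ring
            _ ≤ t := by omega
        exact_mod_cast h1
      · obtain ⟨e, rfl⟩ : ∃ e, d = z + e := ⟨d - z, by omega⟩
        rw [Nat.add_sub_cancel_left, div_pow, mul_div_assoc', le_div_iff₀ (by positivity)]
        have h1 := choose_mul_pow_le (t := t) (ℓ := ℓ) (z := z) (e := e) (by omega) (by omega)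
        have h3 : (t + ℓ).choose z * (8 * ℓ ^ 3 * r) ^ e * (N - (z + e)).choose (K - (z + e)) *
            t ^ e ≤ 4 * H * (16 * ℓ ^ 4 * r) ^ e :=
          calc _ ≤ 2 * t.choose z * (8 * ℓ ^ 3 * r) ^ e * (N - (z + e)).choose (K - (z + e)) *
                t ^ e := by gcongr; exact hch z (by omega)
            _ = 2 * (8 * ℓ ^ 3 * r) ^ e * (N - (z + e)).choose (K - (z + e)) *
                (t.choose z * t ^ e) := by ring
            _ ≤ 2 * (8 * ℓ ^ 3 * r) ^ e * (N - (z + e)).choose (K - (z + e)) *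
                ((2 * ℓ) ^ e * t.choose (z + e)) := by gcongr
            _ = 2 * (t.choose (z + e) * (N - (z + e)).choose (K - (z + e))) *
                ((8 * ℓ ^ 3 * r) ^ e * (2 * ℓ) ^ e) := by ring
            _ ≤ 2 * (2 * H) * ((8 * ℓ ^ 3 * r) ^ e * (2 * ℓ) ^ e) :=
                Nat.mul_le_mul_right _ (Nat.mul_le_mul_left _ (hH' _ hd))
            _ = _ := by rw [← mul_pow]; ring
        exact_mod_cast h3
  obtain ⟨q, hq0, hq1, hq⟩ := key
  have hm : (1 : ℝ) ≤ (min ℓ K : ℕ) := by exact_mod_cast (by omega : 1 ≤ min ℓ K)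
  have hmain := layerBound_mul_le hq0 (by nlinarith) (Nat.cast_nonneg H) hq
  have hH0 : (0 : ℝ) ≤ H := Nat.cast_nonneg H
  have hfin : (50 : ℝ) * ((min ℓ K : ℕ) * (layerBound t r ℓ d * ((N - d).choose (K - d) : ℕ)))
      ≤ H := by
    calc _ ≤ (50 : ℝ) * ((min ℓ K : ℕ) * (8 * H * q)) := by gcongr
      _ = 400 / 625 * (H * (q * (625 * (min ℓ K : ℕ)))) := by ring
      _ ≤ 400 / 625 * (H * 1) := by gcongr
      _ ≤ H := by linarith
  exact_mod_cast hfin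

/-- An irreducible family generates only a small part of `([n] choose k)`. -/
theorem Irreducible.card_restrict_le {n k t r s ℓ K N : ℕ} {T : Finset (Finset (Fin n))}
    (hT : Irreducible T t r ℓ) (hl : 1 ≤ ℓ) (hrs : r ≤ s) (hs : 1 ≤ s)
    (hts : 400 * ℓ ^ 3 * s ≤ t) (hk : t + K = k) (hn : t + N = n)
    (hKN : K + 1000 * s * ℓ * K ≤ N) (hbig : 20000 * s * ℓ ^ 4 * K ≤ n) :
    100 * (restrict (ambient n k) T).card ≤ 6 * (r * extremalSize n k 1 t) := by
  have hlK : ℓ * K ≤ s * ℓ * K := by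
    calc ℓ * K = 1 * ℓ * K := by ring
      _ ≤ _ := by gcongr
  have hKlK : K ≤ ℓ * K := Nat.le_mul_of_pos_left K hl
  have hslK : 1000 * s * ℓ * K = 1000 * (s * ℓ * K) := by ring
  have hH : ∀ x ≤ min ℓ K, (t + 2 * x).choose x * (N - x).choose (K - x) ≤
      2 * extremalSize n k 1 t := fun x hx => by
    refine clique_weight_le hk hn (by omega) (by omega) ?_
    have : 2 * x * (K - x) ≤ 2 * ℓ * K := by gcongr <;> omega
    have : 2 * ℓ * K = 2 * (ℓ * K) := by ring
    omega
  generalize hHdef : extremalSize n k 1 t = H at *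
  have hsub : restrict (ambient n k) T ⊆ (range (min ℓ K + 1)).biUnion fun d =>
      (T.filter fun D => D.card = t + d).biUnion fun D =>
        (ambient n k).filter fun B => D ⊆ B := by
    intro B hB
    rw [restrict, mem_filter] at hB
    obtain ⟨hBk, D, hD, hDB⟩ := hB
    have h1 := le_card_of_not_hasMatching hT.no_matching hD
    have h2 := hT.card_le D hD
    have h3 := card_le_card hDB
    rw [(mem_powersetCard.mp hBk).2] at h3
    exact mem_biUnion.mpr ⟨D.card - t, mem_range.mpr (by omega), mem_biUnion.mpr
      ⟨D, mem_filter.mpr ⟨hD, by omega⟩, mem_filter.mpr ⟨hBk, hDB⟩⟩⟩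
  have hcard : (restrict (ambient n k) T).card ≤ ∑ d ∈ range (min ℓ K + 1),
      (T.filter fun D => D.card = t + d).card * (N - d).choose (K - d) := by
    refine (card_le_card hsub).trans (card_biUnion_le.trans (sum_le_sum fun d hd => ?_))
    rw [mem_range] at hd
    refine card_biUnion_le_card_mul _ _ _ fun D hD => ?_
    rw [mem_filter] at hD
    rw [card_ambient_superset D (by omega), hD.2, show n - (t + d) = N - d by omega,
      show k - (t + d) = K - d by omega]
  -- The layer d = 0 contributes an empty sum, and each of the other min(ℓ, K) layers at most H/(50
  -- min(ℓ, K)).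
  have hsum1 : 50 * ∑ d ∈ range (min ℓ K + 1), layerBound t r ℓ d * (N - d).choose (K - d) ≤
      H := by
    rw [sum_range_succ', show layerBound t r ℓ 0 = 0 by simp [layerBound], zero_mul, add_zero]
    rcases Nat.eq_zero_or_pos (min ℓ K) with h0 | hpos
    · simp [h0]
    refine Nat.le_of_mul_le_mul_left (c := min ℓ K) ?_ hpos
    calc _ = ∑ d ∈ range (min ℓ K), 50 * (min ℓ K *
          (layerBound t r ℓ (d + 1) * (N - (d + 1)).choose (K - (d + 1)))) := by
          rw [mul_sum, mul_sum]
          exact sum_congr rfl fun d _ => by ring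
      _ ≤ ∑ _d ∈ range (min ℓ K), H := sum_le_sum fun d hd => by
          rw [mem_range] at hd
          exact layerBound_weight_le hl hrs hts hs (by omega) (by omega) (by omega)
            (by omega) hH
      _ = min ℓ K * H := by simp
  have hsum2 : ∑ d ∈ range (min ℓ K + 1), (t + 2 * d).choose d * (N - d).choose (K - d) ≤
      2 * ℓ * (2 * H) := by
    calc _ ≤ ∑ _d ∈ range (min ℓ K + 1), 2 * H := sum_le_sum fun d hd =>
          hH d (Nat.lt_succ_iff.mp (mem_range.mp hd))
      _ = (min ℓ K + 1) * (2 * H) := by simp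
      _ ≤ _ := by gcongr; omega
  refine Nat.le_of_mul_le_mul_left (c := 2 * ℓ) ?_ (by omega)
  calc _ = 200 * ℓ * (restrict (ambient n k) T).card := by ring
    _ ≤ 200 * ℓ * ∑ d ∈ range (min ℓ K + 1),
        (T.filter fun D => D.card = t + d).card * (N - d).choose (K - d) := by gcongr
    _ = ∑ d ∈ range (min ℓ K + 1), 200 * ℓ * (T.filter fun D => D.card = t + d).card *
          (N - d).choose (K - d) := by
        rw [mul_sum]
        exact sum_congr rfl fun d _ => by ring
    _ ≤ ∑ d ∈ range (min ℓ K + 1), r * (400 * ℓ * layerBound t r ℓ d + (t + 2 * d).choose d) *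
          (N - d).choose (K - d) := sum_le_sum fun d hd => by
        rw [mem_range] at hd
        exact Nat.mul_le_mul_right _ (hT.card_layer_le (by omega))
    _ = r * (8 * ℓ * (50 * ∑ d ∈ range (min ℓ K + 1),
          layerBound t r ℓ d * (N - d).choose (K - d)) +
          ∑ d ∈ range (min ℓ K + 1), (t + 2 * d).choose d * (N - d).choose (K - d)) := by
        rw [mul_sum, mul_sum, ← sum_add_distrib, mul_sum]
        exact sum_congr rfl fun d _ => by ring
    _ ≤ r * (8 * ℓ * H + 2 * ℓ * (2 * H)) := by gcongr
    _ = 2 * ℓ * (6 * (r * H)) := by ring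

end

end HajnalRothschild

/-! ### The main theorem -/

theorem mainTheorem4 :
    ∃ C : ℝ, 0 < C ∧
      ∀ (n k s t ℓ : ℕ), 2 ≤ n → 2 ≤ k → 1 ≤ s → 1 ≤ t → 1 ≤ ℓ →
        400 * ℓ ^ 3 * s ≤ t →
        (n : ℝ) > k + C * Real.sqrt ((s : ℝ) * t) * ((k : ℝ) - t) →
        (n : ℝ) ≥ C * s * (ℓ : ℝ) ^ 4 * ((k : ℝ) - t) →
        ∀ S : Finset (Finset (Fin n)),
          (∀ A ∈ S, A.card ≤ t + ℓ) →
          HajnalRothschild.matchingNumber S t ≤ (s : ℕ∞) →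
          ∀ F : Finset (Finset (Fin n)),
            HajnalRothschild.restrict F S ⊆
              HajnalRothschild.restrict (HajnalRothschild.ambient n k) S →
            ((HajnalRothschild.restrict F S).card : ℝ) >
              (HajnalRothschild.extremalSize n k s t : ℝ) -
                (1 / 2 + 1 / (10 * (s : ℝ))) * (HajnalRothschild.extremalSize n k 1 t : ℝ) →
            ∃ (x : Fin s → ℕ) (X : Fin s → Finset (Fin n)),
              (∀ i, x i ≤ ℓ ∧ (X i).card = t + 2 * x i) ∧
              S = HajnalRothschild.restrict S (HajnalRothschild.cliqueUnion t x X) := by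
  open HajnalRothschild Finset in
  refine ⟨20000, by norm_num, ?_⟩
  intro n k s t ℓ _ _ hs ht hl hts hn1 hn2 S hS hSm F hFS hF
  have hnm := not_hasMatching_succ_of_matchingNumber_le hSm
  obtain ⟨L, r, T, hLr, hL, hT, hcov⟩ := exists_irreducible ht s hts S hS hnm
  rcases Nat.eq_zero_or_pos r with rfl | hr
  · have hT0 : T = ∅ := by
      rw [eq_empty_iff_forall_notMem]
      intro D hD
      exact hT.no_matching (hasMatching_cons (f := Fin.elim0) (fun i => i.elim0)
        (fun i => i.elim0) hD fun i => i.elim0)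
    obtain rfl : L.length = s := by omega
    refine ⟨fun i => (L.get i).1, fun i => (L.get i).2, fun i => hL _ (List.get_mem L i), ?_⟩
    rw [HajnalRothschild.restrict, eq_comm, filter_eq_self]
    intro A hA
    rcases hcov A hA with ⟨c, hc, hcA⟩ | ⟨D, hD, -⟩
    · obtain ⟨i, rfl⟩ := List.mem_iff_get.mp hc
      obtain ⟨P, hP, hPc⟩ := exists_subset_card_eq hcA
      exact ⟨P, mem_biUnion.mpr ⟨i, mem_univ i, mem_powersetCard.mpr
        ⟨hP.trans inter_subset_right, hPc⟩⟩, hP.trans inter_subset_left⟩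
    · simp [hT0] at hD
  · exfalso
    have hs' : (1 : ℝ) ≤ s := by exact_mod_cast hs
    have hcoef : (1 / 2 + 1 / (10 * (s : ℝ))) ≤ 3 / 5 := by
      have : 1 / (10 * (s : ℝ)) ≤ 1 / 10 := by
        apply one_div_le_one_div_of_le <;> linarith
      linarith
    have hH0 : (0 : ℝ) ≤ extremalSize n k 1 t := Nat.cast_nonneg _
    have hcle : ((restrict F S).card : ℝ) ≤ (restrict (ambient n k) S).card := by
      exact_mod_cast card_le_card hFS
    -- For k < t no k-set contains a member of S and h₁ = 0, so the lower bound on |F[S]| would give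
    -- 0 > h(n,k,s,t).
    rcases lt_or_ge k t with hkt | htk
    · have h1 : (restrict (ambient n k) S) = ∅ := by
        rw [HajnalRothschild.restrict, filter_eq_empty_iff]
        rintro B hB ⟨A, hA, hAB⟩
        have h1 := le_card_of_not_hasMatching hnm hA
        have h2 := card_le_card hAB
        rw [(mem_powersetCard.mp hB).2] at h2
        omega
      have h2 : extremalSize n k 1 t = 0 := by
        have : cliqueSizes n k 1 t = ∅ := by
          rw [Set.eq_empty_iff_forall_notMem]
          rintro N ⟨x, Y, hxY, -⟩
          have := (hxY 0).1
          omega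
        rw [extremalSize, this, csSup_empty]
        rfl
      rw [h1] at hcle
      rw [h2] at hF
      have : (0 : ℝ) ≤ extremalSize n k s t := Nat.cast_nonneg _
      simp only [card_empty, Nat.cast_zero, mul_zero, sub_zero] at hcle hF
      linarith
    · obtain ⟨K, rfl⟩ := Nat.exists_eq_add_of_le htk
      have hKr : ((t + K : ℕ) : ℝ) - t = K := by push_cast; ring
      rw [hKr] at hn1 hn2
      -- From t ≥ 400ℓ²s; the first bound on n thus yields n > k + 400000 sℓK.
      have hsqrt : (20 * s * ℓ : ℝ) ≤ Real.sqrt ((s : ℝ) * t) := by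
        apply Real.le_sqrt_of_sq_le
        have h1 : (20 * s * ℓ) ^ 2 ≤ s * t := by
          calc (20 * s * ℓ) ^ 2 = s * (400 * ℓ ^ 2 * s) := by ring
            _ ≤ s * (400 * ℓ ^ 3 * s) := by
                gcongr
                norm_num
            _ ≤ s * t := by gcongr
        exact_mod_cast h1
      have hn3 : t + K + 400000 * s * ℓ * K < n := by
        have : ((t + K : ℕ) : ℝ) + 400000 * s * ℓ * K < n := by
          calc ((t + K : ℕ) : ℝ) + 400000 * s * ℓ * K
              = ((t + K : ℕ) : ℝ) + 20000 * (20 * s * ℓ) * K := by ring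
            _ ≤ ((t + K : ℕ) : ℝ) + 20000 * Real.sqrt ((s : ℝ) * t) * K := by gcongr
            _ < n := hn1
        exact_mod_cast this
      have hn4 : 20000 * s * ℓ ^ 4 * K ≤ n := by exact_mod_cast hn2
      have e1 : 400000 * s * ℓ * K = 400000 * (s * ℓ * K) := by ring
      have e2 : 1000 * s * ℓ * K = 1000 * (s * ℓ * K) := by ring
      have hts' : 100 * s ≤ t := by
        have : s ≤ ℓ ^ 3 * s := Nat.le_mul_of_pos_left s (by positivity)
        have : 400 * ℓ ^ 3 * s = 400 * (ℓ ^ 3 * s) := by ring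
        omega
      have hTc := hT.card_restrict_le (n := n) (k := t + K) (N := n - t) hl (by omega) hs hts rfl
        (by omega) (by omega) hn4
      have hsmall := mul_extremalSize_one_le (n := n) (K := K) (u := n - (t + K)) ht hs hl rfl (by omega)
        hts' (by omega) (by omega)
      have hext := listFamily_add_le_extremalSize_of_card (n := n) (k := t + K) (r := r) hs
        (by omega) (by omega) hsmall L (fun c hc => (hL c hc).2) hLr
      have hsub : restrict (ambient n (t + K)) S ⊆
          listFamily n (t + K) t L ∪ restrict (ambient n (t + K)) T := by
        intro B hB
        rw [HajnalRothschild.restrict, mem_filter] at hB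
        obtain ⟨hBk, A, hA, hAB⟩ := hB
        rw [mem_union, listFamily, HajnalRothschild.restrict, mem_filter, mem_filter]
        rcases hcov A hA with ⟨c, hc, hcA⟩ | ⟨D, hD, hDA⟩
        · exact Or.inl ⟨hBk, c, hc, hcA.trans (card_le_card (inter_subset_inter_right hAB))⟩
        · exact Or.inr ⟨hBk, D, hD, hDA.trans hAB⟩
      have hcard := (card_le_card hsub).trans (card_union_le _ _)
      have hrH : extremalSize n (t + K) 1 t ≤ r * extremalSize n (t + K) 1 t :=
        Nat.le_mul_of_pos_left _ hr
      have hmul : (1 / 2 + 1 / (10 * (s : ℝ))) * (extremalSize n (t + K) 1 t : ℝ) ≤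
          3 / 5 * (extremalSize n (t + K) 1 t : ℝ) := by gcongr
      -- With r ≥ 1, the gain 99 r h₁ and the loss 6 r h₁ leave at least 93 h₁.
      have hnat : 100 * (restrict (ambient n (t + K)) S).card +
          93 * extremalSize n (t + K) 1 t ≤ 100 * extremalSize n (t + K) s t := by omega
      have hreal : 100 * ((restrict (ambient n (t + K)) S).card : ℝ) +
          93 * extremalSize n (t + K) 1 t ≤ 100 * extremalSize n (t + K) s t := by
        exact_mod_cast hnat
      linarith
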